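/- Let $\mathbb F_q$ be a finite field. For $n\ge 0$ let $C_n(q)$ be the complex vector space of functions $f:\mathfrak{gl}_n(\mathbb F_q)\to\mathbb C$ with $f(gxg^{-1})=f(x)$ for all $g\in \mathrm{GL}_n(\mathbb F_q)$ (with $\mathfrak{gl}_0(\mathbb F_q)=\{0\}$, so $C_0(q)=\mathbb C$), and let $C(q)=\bigoplus_{n\ge 0}C_n(q)$. For an $\mathbb F_q$-rational parabolic subgroup $P$ of $G=\mathrm{GL}_n$ with unipotent radical $U_P$ and an $\mathbb F_q$-rational Levi subgroup $L$ of $P$, let $\mathcal P,\mathcal U_P,\mathcal L$ be the sets of $\mathbb F_q$-points of their Lie algebras and let $\pi_{\mathcal L}:\mathcal P\to\mathcal L$ be the projection along $\mathcal U_P$. Put $${}^*R_{\mathcal L\subseteq\mathcal P}(f)(x)=\frac1{|U_P(\mathbb F_q)|}\sum_{y\in\mathcal U_P}f(x+y)\quad(x\in\mathcal L),\qquad R_{\mathcal L\subseteq\mathcal P}(f)(x)=\frac1{|P(\mathbb F_q)|}\sum_{\substack{g\in \mathrm{GL}_n(\mathbb F_q)\\ gxg^{-1}\in\mathcal P}}f(\pi_{\mathcal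 L}(gxg^{-1})).$$ For $k+l=n$ take $L$ to be the block diagonal subgroup $\mathrm{GL}_k\times\mathrm{GL}_l$ of $\mathrm{GL}_n$ and $P$ the corresponding block upper triangular subgroup, and identify $C_k(q)\otimes C_l(q)$ with the space of invariant functions on $\mathcal L=\mathfrak{gl}_k(\mathbb F_q)\times\mathfrak{gl}_l(\mathbb F_q)$. Then $R_{\mathcal L\subseteq\mathcal P}$ and ${}^*R_{\mathcal L\subseteq\mathcal P}$ define maps $m_{k,l}:C_k(q)\otimes C_l(q)\to C_n(q)$ and $m^*_{k,l}:C_n(q)\to C_k(q)\otimes C_l(q)$. Let $m:C(q)\otimes C(q)\to C(q)$ be the sum of all $m_{k,l}$, let $m^*:C(q)\to C(q)\otimes C(q)$ be $\sum_{k+l=n}m^*_{k,l}$ on each $C_n(q)$, and let $e:\mathbb C=C_0(q)\to C(q)$ and $e^*:C(q)\to C_0(q)=\mathbb C$ be the inclusion and the projection. An antipode of $C(q)$ is a linear endomorphism $S$ of $C(q)$ that is a two-sided inverse of the identity for the convolution product: $m\circ(S\otimes\mathrm{id})\circ m^*=e\circ e^*=m\circ(\mathrm{id}\otimes S)\circ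 m^*$. The duality operation $\mathcal D_n:C_n(q)\to C_n(q)$ is $$\mathcal D_n=\sum_P(-1)^{r(P)}R_{\mathcal L_P\subseteq\mathcal P}\circ{}^*R_{\mathcal L_P\subseteq\mathcal P},$$ where $P$ runs over the $\mathbb F_q$-rational parabolic subgroups of $\mathrm{GL}_n$ containing a fixed $\mathbb F_q$-rational Borel subgroup, $\mathcal L_P$ is the Lie algebra of a chosen $\mathbb F_q$-rational Levi subgroup of $P$, and $r(P)$ is the semisimple $\mathbb F_q$-rank of $P$ (that is, $n-s$ if the Levi subgroups of $P$ are isomorphic to $\mathrm{GL}_{n_1}\times\dots\times\mathrm{GL}_{n_s}$ with all $n_i\ge1$); $\mathcal D_0=\mathrm{id}$. **Proposition.** $C(q)$ has exactly one antipode $S$, and for every choice of the Borel and Levi subgroups (for each $n$) $$S=\bigoplus_{n\ge0}(-1)^n\,\mathcal D_n$$ as graded linear endomorphisms of $C(q)$. Equivalently, $\mathcal D_n=(-1)^n\,S|_{C_n(q)}$ for every $n\ge 0$. -/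

import Mathlib

open scoped TensorProduct DirectSum Matrix

noncomputable section

namespace GLInv

/-- `𝔤𝔩ₙ(F)`. -/
abbrev Mat (F : Type*) (n : ℕ) : Type _ := Matrix (Fin n) (Fin n) F

/-- The adjoint action `g x g⁻¹` of `GLₙ(F)` on `𝔤𝔩ₙ(F)`. -/
def Ad {F : Type*} [Field F] {n : ℕ} (g : GL (Fin n) F) (x : Mat F n) : Mat F n :=
  (g : Mat F n) * x * ((g⁻¹ : GL (Fin n) F) : Mat F n)

theorem Ad_mul {F : Type*} [Field F] {n : ℕ} (g h : GL (Fin n) F) (x : Mat F n) :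
    Ad (g * h) x = Ad g (Ad h x) := by
  simp [Ad, mul_assoc]

theorem Ad_one {F : Type*} [Field F] {n : ℕ} (x : Mat F n) :
    Ad (1 : GL (Fin n) F) x = x := by
  simp [Ad]

theorem Ad_add {F : Type*} [Field F] {n : ℕ} (g : GL (Fin n) F) (x y : Mat F n) :
    Ad g (x + y) = Ad g x + Ad g y := by
  simp [Ad, mul_add, add_mul]

theorem Ad_smul {F : Type*} [Field F] {n : ℕ} (g : GL (Fin n) F) (a : F) (x : Mat F n) :
    Ad g (a • x) = a • Ad g x := by
  simp [Ad]

/-! ### Invariant functions -/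

/-- `Cₙ(q)`: the complex-valued functions on `𝔤𝔩ₙ(F)` invariant under the adjoint action. -/
def invFun (F : Type*) [Field F] (n : ℕ) : Submodule ℂ (Mat F n → ℂ) where
  carrier := {f | ∀ (g : GL (Fin n) F) (x : Mat F n), f (Ad g x) = f x}
  add_mem' hf hg a x := by simp [hf a x, hg a x]
  zero_mem' _ _ := rfl
  smul_mem' c f hf a x := by simp [hf a x]

/-- The `GLₖ(F) × GLₗ(F)`-invariant complex functions on `𝔤𝔩ₖ(F) × 𝔤𝔩ₗ(F)`. -/
def invFunProd (F : Type*) [Field F] (k l : ℕ) : Submodule ℂ (Mat F k × Mat F l → ℂ) where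
  carrier := {f | ∀ (g : GL (Fin k) F) (h : GL (Fin l) F) (x : Mat F k) (y : Mat F l),
    f (Ad g x, Ad h y) = f (x, y)}
  add_mem' hf hg a b x y := by simp [hf a b x y, hg a b x y]
  zero_mem' _ _ _ _ := rfl
  smul_mem' c f hf a b x y := by simp [hf a b x y]

/-- The external product `f ⊗ g ↦ ((x, y) ↦ f x * g y)`. -/
def boxTensor (F : Type*) [Field F] (k l : ℕ) :
    (invFun F k ⊗[ℂ] invFun F l) →ₗ[ℂ] invFunProd F k l :=
  TensorProduct.lift (LinearMap.mk₂ ℂ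
    (fun f g => ⟨fun z => f.1 z.1 * g.1 z.2, fun a b x y => by
      simp only [f.2 a x, g.2 b y]⟩)
    (fun f f' g => by ext z; simp [add_mul])
    (fun c f g => by ext z; simp [mul_assoc])
    (fun f g g' => by ext z; simp [mul_add])
    (fun c f g => by ext z; simp [mul_left_comm]))

theorem boxTensor_tmul (F : Type*) [Field F] (k l : ℕ) (f : invFun F k) (g : invFun F l)
    (z : Mat F k × Mat F l) :
    (boxTensor F k l (f ⊗ₜ[ℂ] g)).1 z = f.1 z.1 * g.1 z.2 := rfl

theorem boxTensor_injective (F : Type*) [Field F] [Fintype F] (k l : ℕ) :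
    Function.Injective (boxTensor F k l) := by
  classical
  refine (injective_iff_map_eq_zero _).2 fun t ht => ?_
  have hinj : Function.Injective
      (TensorProduct.map (invFun F k).subtype (invFun F l).subtype) :=
    TensorProduct.map_injective_of_flat_flat _ _ Subtype.val_injective Subtype.val_injective
  apply hinj
  rw [map_zero]
  let e := (Pi.basisFun ℂ (Mat F k)).tensorProduct (Pi.basisFun ℂ (Mat F l))
  apply e.repr.injective
  rw [map_zero]
  ext z
  have key : ∀ t : invFun F k ⊗[ℂ] invFun F l,
      e.repr (TensorProduct.map (invFun F k).subtype (invFun F l).subtype t) z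
        = (boxTensor F k l t).1 z := by
    intro t
    induction t with
    | zero => simp
    | add a b ha hb => simp only [map_add, Finsupp.add_apply, ha, hb]; rfl
    | tmul f g =>
      obtain ⟨x, y⟩ := z
      simp [e, boxTensor_tmul, mul_comm]
  rw [key, ht]
  rfl

/-- The averaged indicator function of `a`. -/
def avgDelta (F : Type*) [Field F] [Fintype F] [DecidableEq F] (n : ℕ) (a : Mat F n) :
    invFun F n :=
  ⟨fun x => (Fintype.card (GL (Fin n) F) : ℂ)⁻¹ *
      ∑ g : GL (Fin n) F, if Ad g x = a then (1 : ℂ) else 0, fun h x => by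
    beta_reduce
    congr 1
    refine Fintype.sum_equiv (Equiv.mulRight h) _ _ fun g => ?_
    simp [Ad_mul]⟩

theorem sum_avgDelta (F : Type*) [Field F] [Fintype F] [DecidableEq F] (n : ℕ)
    (f : Mat F n → ℂ) (x : Mat F n) :
    ∑ a, f a * (avgDelta F n a).1 x =
      (Fintype.card (GL (Fin n) F) : ℂ)⁻¹ * ∑ g : GL (Fin n) F, f (Ad g x) := by
  have h1 : ∀ a, f a * (avgDelta F n a).1 x = (Fintype.card (GL (Fin n) F) : ℂ)⁻¹ *
      ∑ g : GL (Fin n) F, if Ad g x = a then f a else 0 := by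
    intro a
    simp only [avgDelta]
    rw [mul_left_comm, Finset.mul_sum]
    simp
  rw [Finset.sum_congr rfl fun a _ => h1 a, ← Finset.mul_sum, Finset.sum_comm]
  simp

theorem boxTensor_surjective (F : Type*) [Field F] [Fintype F] (k l : ℕ) :
    Function.Surjective (boxTensor F k l) := by
  classical
  intro f
  refine ⟨∑ a : Mat F k, ∑ b : Mat F l, f.1 (a, b) • (avgDelta F k a ⊗ₜ[ℂ] avgDelta F l b), ?_⟩
  ext ⟨x, y⟩
  have hcard : ∀ n, (Fintype.card (GL (Fin n) F) : ℂ) ≠ 0 := fun n => by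
    exact_mod_cast Fintype.card_ne_zero
  have h1 : ((boxTensor F k l (∑ a : Mat F k, ∑ b : Mat F l,
      f.1 (a, b) • (avgDelta F k a ⊗ₜ[ℂ] avgDelta F l b))).1 (x, y) : ℂ) =
      ∑ a : Mat F k, (∑ b : Mat F l, f.1 (a, b) * (avgDelta F l b).1 y) *
        (avgDelta F k a).1 x := by
    simp only [map_sum, map_smul, AddSubmonoidClass.coe_finsetSum, Finset.sum_apply,
      Submodule.coe_smul, Pi.smul_apply, smul_eq_mul, boxTensor_tmul, Finset.sum_mul]
    refine Finset.sum_congr rfl fun a _ => Finset.sum_congr rfl fun b _ => by ring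
  rw [h1, sum_avgDelta F k (fun a => ∑ b : Mat F l, f.1 (a, b) * (avgDelta F l b).1 y)]
  have h2 : ∀ a, ∑ b : Mat F l, f.1 (a, b) * (avgDelta F l b).1 y =
      (Fintype.card (GL (Fin l) F) : ℂ)⁻¹ * ∑ h : GL (Fin l) F, f.1 (a, Ad h y) :=
    fun a => sum_avgDelta F l (fun b => f.1 (a, b)) y
  have h3 : ∀ (g : GL (Fin k) F) (h : GL (Fin l) F), f.1 (Ad g x, Ad h y) = f.1 (x, y) :=
    fun g h => f.2 g h x y
  simp only [h2, h3]
  simp [hcard]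

/-- The identification `Cₖ(q) ⊗ Cₗ(q) ≅ C(𝔤𝔩ₖ(F) × 𝔤𝔩ₗ(F))`. -/
def boxEquiv (F : Type*) [Field F] [Fintype F] (k l : ℕ) :
    (invFun F k ⊗[ℂ] invFun F l) ≃ₗ[ℂ] invFunProd F k l :=
  LinearEquiv.ofBijective (boxTensor F k l) ⟨boxTensor_injective F k l, boxTensor_surjective F k l⟩

/-! ### Parabolic subgroups and Levi subgroups

A labelling `b : Fin n → ℕ` of the coordinates gives the standard parabolic subgroup of block upper
triangular matrices and its standard block diagonal Levi subgroup (for monotone `b` these are the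
usual ones); an element `h` of `GLₙ(F)` conjugates the pair.  All definitions below are for the
`h`-conjugate of the pair attached to `b`. -/

/-- The `F`-points of the parabolic subgroup `P = h P_b h⁻¹`. -/
def parabolic {F : Type*} [Field F] {n : ℕ} (h : GL (Fin n) F) (b : Fin n → ℕ) :
    Subgroup (GL (Fin n) F) where
  carrier := {g | (Ad h⁻¹ (g : Mat F n)).BlockTriangular b}
  mul_mem' {x y} hx hy := by
    have : Ad h⁻¹ ((x * y : GL (Fin n) F) : Mat F n)
        = Ad h⁻¹ (x : Mat F n) * Ad h⁻¹ (y : Mat F n) := by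
      simp [Ad, mul_assoc]
    simp only [Set.mem_ofPred_eq] at hx hy ⊢
    rw [this]
    exact hx.mul hy
  one_mem' := by
    have : Ad h⁻¹ ((1 : GL (Fin n) F) : Mat F n) = 1 := by
      simp [Ad]
    simp only [Set.mem_ofPred_eq]
    rw [this]
    exact Matrix.blockTriangular_one
  inv_mem' {x} hx := by
    have e1 : ∀ y : GL (Fin n) F,
        Ad h⁻¹ (y : Mat F n) = ((h⁻¹ * y * h : GL (Fin n) F) : Mat F n) := by
      intro y; simp [Ad]
    simp only [Set.mem_ofPred_eq] at hx ⊢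
    rw [e1] at hx ⊢
    have e2 : h⁻¹ * x⁻¹ * h = (h⁻¹ * x * h)⁻¹ := by group
    rw [e2, Matrix.coe_units_inv]
    let _ := (h⁻¹ * x * h).invertible
    exact Matrix.blockTriangular_inv_of_blockTriangular hx

/-- The Lie algebra `𝒫` of `P`. -/
def parabolicLie {F : Type*} [Field F] {n : ℕ} (h : GL (Fin n) F) (b : Fin n → ℕ) :
    Submodule F (Mat F n) where
  carrier := {x | ∀ i j, b j < b i → Ad h⁻¹ x i j = 0}
  add_mem' hx hy i j hij := by rw [Ad_add]; simp [hx i j hij, hy i j hij]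
  zero_mem' i j _ := by simp [Ad]
  smul_mem' c x hx i j hij := by rw [Ad_smul]; simp [hx i j hij]

/-- The Lie algebra `𝒰_P` of the unipotent radical `U_P` of `P`. -/
def unipLie {F : Type*} [Field F] {n : ℕ} (h : GL (Fin n) F) (b : Fin n → ℕ) :
    Submodule F (Mat F n) where
  carrier := {x | ∀ i j, b j ≤ b i → Ad h⁻¹ x i j = 0}
  add_mem' hx hy i j hij := by rw [Ad_add]; simp [hx i j hij, hy i j hij]
  zero_mem' i j _ := by simp [Ad]
  smul_mem' c x hx i j hij := by rw [Ad_smul]; simp [hx i j hij]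

/-- The Lie algebra `ℒ` of the Levi subgroup `L = h L_b h⁻¹` of `P`. -/
def levi {F : Type*} [Field F] {n : ℕ} (h : GL (Fin n) F) (b : Fin n → ℕ) :
    Submodule F (Mat F n) where
  carrier := {x | ∀ i j, b i ≠ b j → Ad h⁻¹ x i j = 0}
  add_mem' hx hy i j hij := by rw [Ad_add]; simp [hx i j hij, hy i j hij]
  zero_mem' i j _ := by simp [Ad]
  smul_mem' c x hx i j hij := by rw [Ad_smul]; simp [hx i j hij]

/-- The projection `π_ℒ`: keep the diagonal blocks.  On `𝒫 = ℒ ⊕ 𝒰_P` this is the projection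
to `ℒ` along `𝒰_P`; it is only used there. -/
def leviProj {F : Type*} [Field F] {n : ℕ} (h : GL (Fin n) F) (b : Fin n → ℕ) (x : Mat F n) :
    levi h b :=
  ⟨Ad h (Matrix.of fun i j => if b i = b j then Ad h⁻¹ x i j else 0), fun i j hij => by
    rw [← Ad_mul]; simp [Ad_one, hij]⟩

/-! ### Harish-Chandra restriction and induction -/

open Classical in
/-- Harish-Chandra restriction
`f ↦ (x ↦ |U_P|⁻¹ ∑_{y ∈ 𝒰_P} f (x + y))`, where `|U_P| = |𝒰_P|` via `u ↦ u - 1`. -/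
def hcRes {F : Type*} [Field F] [Fintype F] {n : ℕ} (h : GL (Fin n) F) (b : Fin n → ℕ) :
    invFun F n →ₗ[ℂ] (levi h b → ℂ) where
  toFun f x :=
    (Nat.card (unipLie h b) : ℂ)⁻¹ * ∑ y : unipLie h b, f.1 ((x : Mat F n) + (y : Mat F n))
  map_add' f g := by ext x; simp [Finset.sum_add_distrib, mul_add]
  map_smul' c f := by
    ext x
    simp [← Finset.mul_sum, mul_left_comm]

open Classical in
/-- Harish-Chandra induction
`f ↦ (x ↦ |P|⁻¹ ∑_{g ∈ GLₙ(F), g x g⁻¹ ∈ 𝒫} f (π_ℒ (g x g⁻¹)))`. -/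
def hcInd {F : Type*} [Field F] [Fintype F] {n : ℕ} (h : GL (Fin n) F) (b : Fin n → ℕ) :
    (levi h b → ℂ) →ₗ[ℂ] invFun F n where
  toFun f := ⟨fun x => (Nat.card (parabolic h b) : ℂ)⁻¹ *
      ∑ g : GL (Fin n) F, if Ad g x ∈ parabolicLie h b then f (leviProj h b (Ad g x)) else (0 : ℂ),
    fun a x => by
      beta_reduce
      congr 1
      refine Fintype.sum_equiv (Equiv.mulRight a) _ _ fun g => ?_
      simp [Ad_mul]⟩
  map_add' f g := by
    ext x
    simp [← mul_add, ← Finset.sum_add_distrib, ite_add_ite]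
  map_smul' c f := by
    ext x
    simp [Finset.mul_sum, mul_left_comm]

/-! ### The graded space `C(q)` and its structure maps -/

/-- `C(q) = ⨁ₙ Cₙ(q)`. -/
abbrev Cq (F : Type*) [Field F] : Type _ := ⨁ n : ℕ, invFun F n

/-- The labelling attached to the two-block pair `(k, l)`, `k + l = n`: the first `k` coordinates
form the first block. -/
def twoBlocks (k n : ℕ) : Fin n → ℕ := fun i => if (i : ℕ) < k then 0 else 1

/-- `diag(x, y) ∈ ℒ_{k,l}`. -/
def blockDiag {F : Type*} [Field F] {k l n : ℕ} (hn : k + l = n) (x : Mat F k) (y : Mat F l) :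
    levi (1 : GL (Fin n) F) (twoBlocks k n) :=
  ⟨Matrix.reindex (finSumFinEquiv.trans (finCongr hn)) (finSumFinEquiv.trans (finCongr hn))
      (Matrix.fromBlocks x 0 0 y), by
    subst hn
    intro i j hij
    rw [inv_one, Ad_one]
    induction i using Fin.addCases <;> induction j using Fin.addCases <;>
      simp_all [twoBlocks]⟩

/-- The upper left `k × k` block. -/
def topBlock {F : Type*} {k l n : ℕ} (hn : k + l = n) (x : Mat F n) : Mat F k :=
  x.submatrix (fun i => finCongr hn (Fin.castAdd l i)) (fun i => finCongr hn (Fin.castAdd l i))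

/-- The lower right `l × l` block. -/
def botBlock {F : Type*} {k l n : ℕ} (hn : k + l = n) (x : Mat F n) : Mat F l :=
  x.submatrix (fun i => finCongr hn (Fin.natAdd k i)) (fun i => finCongr hn (Fin.natAdd k i))

/-- A function on `𝔤𝔩ₖ × 𝔤𝔩ₗ` viewed as a function on `ℒ_{k,l}`. -/
def toLevi (F : Type*) [Field F] {k l n : ℕ} (hn : k + l = n) :
    invFunProd F k l →ₗ[ℂ] (levi (1 : GL (Fin n) F) (twoBlocks k n) → ℂ) where
  toFun f x := f.1 (topBlock hn x.1, botBlock hn x.1)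
  map_add' _ _ := rfl
  map_smul' _ _ := rfl

/-- `m_{k,l} : Cₖ(q) ⊗ Cₗ(q) → Cₙ(q)`, `n = k + l`: Harish-Chandra induction `R_{k,l}^n`. -/
def mulComp (F : Type*) [Field F] [Fintype F] {k l n : ℕ} (hn : k + l = n) :
    (invFun F k ⊗[ℂ] invFun F l) →ₗ[ℂ] invFun F n :=
  hcInd 1 (twoBlocks k n) ∘ₗ toLevi F hn ∘ₗ (boxEquiv F k l).toLinearMap

/-- The block diagonal element `diag(g, h)` of `GLₙ(F)`. -/
def blockGL {F : Type*} [Field F] {k l n : ℕ} (hn : k + l = n)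
    (g : GL (Fin k) F) (h : GL (Fin l) F) : GL (Fin n) F where
  val := (blockDiag hn (g : Mat F k) (h : Mat F l)).1
  inv := (blockDiag hn ((g⁻¹ : GL (Fin k) F) : Mat F k) ((h⁻¹ : GL (Fin l) F) : Mat F l)).1
  val_inv := by
    simp only [blockDiag, Matrix.reindex_apply, Matrix.submatrix_mul_equiv,
      Matrix.fromBlocks_multiply]
    simp [-Matrix.coe_units_inv, Function.comp_def]
    exact Matrix.submatrix_one _ fun i j hij => by simpa using hij
  inv_val := by
    simp only [blockDiag, Matrix.reindex_apply, Matrix.submatrix_mul_equiv,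
      Matrix.fromBlocks_multiply]
    simp [-Matrix.coe_units_inv, Function.comp_def]
    exact Matrix.submatrix_one _ fun i j hij => by simpa using hij

theorem Ad_blockGL {F : Type*} [Field F] {k l n : ℕ} (hn : k + l = n)
    (g : GL (Fin k) F) (h : GL (Fin l) F) (x : Mat F k) (y : Mat F l) :
    Ad (blockGL hn g h) (blockDiag hn x y).1 = (blockDiag hn (Ad g x) (Ad h y)).1 := by
  have : ((blockGL hn g h)⁻¹ : GL (Fin n) F).1 =
    (blockDiag hn ((g⁻¹ : GL (Fin k) F) : Mat F k) ((h⁻¹ : GL (Fin l) F) : Mat F l)).1 := rfl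
  simp only [Ad, this]
  simp only [blockGL, blockDiag, Matrix.reindex_apply, Matrix.submatrix_mul_equiv,
      Matrix.fromBlocks_multiply]
  simp [-Matrix.coe_units_inv]

theorem Ad_blockGL_mem {F : Type*} [Field F] {k l n : ℕ} (hn : k + l = n)
    (g : GL (Fin k) F) (h : GL (Fin l) F) {y : Mat F n}
    (hy : y ∈ unipLie (1 : GL (Fin n) F) (twoBlocks k n)) :
    Ad (blockGL hn g h) y ∈ unipLie (1 : GL (Fin n) F) (twoBlocks k n) := by
  intro i j hij
  have hy' : ∀ i j, twoBlocks k n j ≤ twoBlocks k n i → y i j = 0 := by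
    intro i j h; have := hy i j h; rwa [inv_one, Ad_one] at this
  have h1 : ∀ a b, twoBlocks k n a ≠ twoBlocks k n b → (blockGL hn g h).1 a b = 0 := by
    intro a b hab
    have := (blockDiag hn (g : Mat F k) (h : Mat F l)).2 a b hab
    rwa [inv_one, Ad_one] at this
  have h2 : ∀ a b, twoBlocks k n a ≠ twoBlocks k n b → ((blockGL hn g h)⁻¹).1 a b = 0 := by
    intro a b hab
    have := (blockDiag hn ((g⁻¹ : GL (Fin k) F) : Mat F k)
      ((h⁻¹ : GL (Fin l) F) : Mat F l)).2 a b hab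
    rwa [inv_one, Ad_one] at this
  rw [inv_one, Ad_one]
  simp only [Ad, Matrix.mul_apply]
  refine Finset.sum_eq_zero fun b _ => ?_
  by_cases hb : twoBlocks k n b = twoBlocks k n j
  · rw [Finset.sum_eq_zero, zero_mul]
    intro a _
    by_cases ha : twoBlocks k n i = twoBlocks k n a
    · rw [hy' a b (by omega), mul_zero]
    · rw [h1 i a ha, zero_mul]
  · rw [h2 b j hb, mul_zero]

open Classical in
/-- Harish-Chandra restriction `*R_{k,l}^n` read as a map `C(𝔤𝔩ₙ) → C(𝔤𝔩ₖ × 𝔤𝔩ₗ)`. -/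
def resProd (F : Type*) [Field F] [Fintype F] {k l n : ℕ} (hn : k + l = n) :
    invFun F n →ₗ[ℂ] invFunProd F k l where
  toFun f := ⟨fun z => hcRes 1 (twoBlocks k n) f (blockDiag hn z.1 z.2), fun g h x y => by
    simp only [hcRes, LinearMap.coe_mk, AddHom.coe_mk]
    congr 1
    refine (Fintype.sum_bijective
      (fun w => (⟨Ad (blockGL hn g h) w.1, Ad_blockGL_mem hn g h w.2⟩ :
        unipLie (1 : GL (Fin n) F) (twoBlocks k n)))
      (Finite.injective_iff_bijective.1 fun v w hvw => ?_) _ _ fun w => ?_).symm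
    · have h1 := congrArg (Ad (blockGL hn g h)⁻¹) (Subtype.ext_iff.1 hvw)
      simp only [← Ad_mul, inv_mul_cancel, Ad_one] at h1
      exact Subtype.ext h1
    · rw [← Ad_blockGL, ← Ad_add, f.2]⟩
  map_add' f g := by ext z; simp
  map_smul' c f := by ext z; simp

/-- `m*_{k,l} : Cₙ(q) → Cₖ(q) ⊗ Cₗ(q)`, `n = k + l`. -/
def comulComp (F : Type*) [Field F] [Fintype F] {k l n : ℕ} (hn : k + l = n) :
    invFun F n →ₗ[ℂ] (invFun F k ⊗[ℂ] invFun F l) :=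
  (boxEquiv F k l).symm.toLinearMap ∘ₗ resProd F hn

/-- The multiplication `m : C(q) ⊗ C(q) → C(q)`, the sum of all `m_{k,l}`. -/
def mul (F : Type*) [Field F] [Fintype F] : (Cq F ⊗[ℂ] Cq F) →ₗ[ℂ] Cq F :=
  TensorProduct.lift
    (DirectSum.toModule ℂ ℕ _ fun k =>
      LinearMap.flip (DirectSum.toModule ℂ ℕ _ fun l =>
        LinearMap.flip (TensorProduct.curry
          (DirectSum.lof ℂ ℕ (fun n => invFun F n) (k + l) ∘ₗ mulComp F rfl))))

/-- The comultiplication `m* : C(q) → C(q) ⊗ C(q)`, which is `∑_{k+l=n} m*_{k,l}` on `Cₙ(q)`. -/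
def comul (F : Type*) [Field F] [Fintype F] : Cq F →ₗ[ℂ] (Cq F ⊗[ℂ] Cq F) :=
  DirectSum.toModule ℂ ℕ _ fun n =>
    ∑ p : {p : ℕ × ℕ // p ∈ Finset.HasAntidiagonal.antidiagonal n},
      TensorProduct.map (DirectSum.lof ℂ ℕ (fun n => invFun F n) p.1.1)
        (DirectSum.lof ℂ ℕ (fun n => invFun F n) p.1.2) ∘ₗ
      comulComp F (Finset.HasAntidiagonal.mem_antidiagonal.1 p.2)

/-- The unit `e : ℂ = C₀(q) → C(q)`; a scalar is a constant function on `𝔤𝔩₀(F) = {0}`. -/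
def unit (F : Type*) [Field F] : ℂ →ₗ[ℂ] Cq F :=
  DirectSum.lof ℂ ℕ (fun n => invFun F n) 0 ∘ₗ
    { toFun := fun c => ⟨fun _ => c, fun _ _ => rfl⟩
      map_add' := fun _ _ => rfl
      map_smul' := fun _ _ => rfl }

/-- The counit `e* : C(q) → C₀(q) = ℂ`. -/
def counit (F : Type*) [Field F] : Cq F →ₗ[ℂ] ℂ :=
  { toFun := fun f : invFun F 0 => f.1 0
    map_add' := fun _ _ => rfl
    map_smul' := fun _ _ => rfl } ∘ₗ
    DirectSum.component ℂ ℕ (fun n => invFun F n) 0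

/-! ### Antipode -/

/-- The convolution product `S * T = m ∘ (S ⊗ T) ∘ m*` of linear endomorphisms of `C(q)`. -/
def convolution {F : Type*} [Field F] [Fintype F] (S T : Cq F →ₗ[ℂ] Cq F) : Cq F →ₗ[ℂ] Cq F :=
  mul F ∘ₗ TensorProduct.map S T ∘ₗ comul F

/-- An antipode: a two-sided inverse of the identity for the convolution product, whose neutral
element is `e ∘ e*`. -/
def IsAntipode {F : Type*} [Field F] [Fintype F] (S : Cq F →ₗ[ℂ] Cq F) : Prop :=
  convolution S LinearMap.id = unit F ∘ₗ counit F ∧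
    convolution LinearMap.id S = unit F ∘ₗ counit F

/-! ### The duality operation -/

/-- The labelling attached to a composition of `n`: consecutive blocks of the prescribed sizes. -/
def compBlocks {n : ℕ} (c : Composition n) : Fin n → ℕ := fun i => (c.index i : ℕ)

/-- A choice of data for the duality operation on `Cₙ(q)`.  The Borel subgroup is `a B a⁻¹`, with
`B` the upper triangular subgroup.  The parabolic subgroups containing it are
`P = a P_c a⁻¹`, for `c` a composition of `n`.  The Levi subgroups of `P` defined over `F` are
`(a p) L_c (a p)⁻¹` with `p ∈ P_c(F)`; one is chosen for every `c`. -/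
structure BorelLeviChoice (F : Type*) [Field F] (n : ℕ) where
  /-- The element `a` which conjugates the Borel subgroup. -/
  borel : GL (Fin n) F
  /-- The element `p ∈ P_c(F)` which conjugates the Levi subgroup. -/
  levi : (c : Composition n) → parabolic (1 : GL (Fin n) F) (compBlocks c)

/-- The element `h = a p` with `P = h P_c h⁻¹` and `L_P = h L_c h⁻¹`. -/
def BorelLeviChoice.conj {F : Type*} [Field F] {n : ℕ} (χ : BorelLeviChoice F n)
    (c : Composition n) : GL (Fin n) F :=
  χ.borel * (χ.levi c : GL (Fin n) F)

/-- The duality operation `𝒟ₙ = ∑_P (-1)^{r(P)} R_{ℒ_P} ∘ *R_{ℒ_P}`.  The Levi subgroup attached to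
`c = (n₁, …, n_s)` is `GL_{n₁} × ⋯ × GL_{n_s}`, of semisimple `F`-rank `∑ (nᵢ - 1) = n - s`. -/
def duality {F : Type*} [Field F] [Fintype F] {n : ℕ} (χ : BorelLeviChoice F n) :
    invFun F n →ₗ[ℂ] invFun F n :=
  ∑ c : Composition n, (-1 : ℂ) ^ (n - c.length) •
    (hcInd (χ.conj c) (compBlocks c) ∘ₗ hcRes (χ.conj c) (compBlocks c))

/-- `⨁ₙ (-1)ⁿ 𝒟ₙ` as a graded endomorphism of `C(q)`. -/
def signedDuality {F : Type*} [Field F] [Fintype F] (χ : (n : ℕ) → BorelLeviChoice F n) :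
    Cq F →ₗ[ℂ] Cq F :=
  DirectSum.lmap fun n => (-1 : ℂ) ^ n • duality (χ n)

end GLInv

end

open scoped TensorProduct DirectSum Matrix

noncomputable section

namespace GLInv

/-! ### The composite `R ∘ *R` and its independence of the choices -/

section Standard

variable {F : Type*} [Field F] {n : ℕ}

/-! The result is Takeuchi's formula for the antipode of a connected graded object, with
Harish-Chandra theory supplying its terms.

For a parabolic P, the projection to ℒ moves an element of 𝒫 only inside its 𝒰_P-coset, over which
`*R` averages; so `R ∘ *R` depends on P alone, and by invariance only on the conjugacy class of P
(`hcInd_comp_hcRes`). Thus `(-1)ⁿ 𝒟ₙ` is the alternating sum `signedAvg` of operators `hcAvg` over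
compositions of n, with sign `(-1)^length`.

Transitivity (`IsConcat.hcAvg_eq`) says that the operator of a concatenated composition is the
convolution of the operators of its two parts. Since a one-block composition gives the identity,
convolving `signedAvg` with the identity on C_l for l > 0 appends a block l and reverses the sign of
each term relative to the longer composition. The term l = 0 returns `signedAvg` itself, so summing
over k + l = n cancels every nonempty composition, according to its last block; only degree 0
survives. On the other side the first block plays this role.

For uniqueness, the component of D * id on Cₙ has D itself as its (n, 0) term, and all other terms
involve D in lower degree. Hence D * id = 0 forces D = 0 by induction
(`eq_zero_of_convolution_id_eq_zero`). Neither associativity nor coassociativity is needed. -/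

theorem Ad_inv_Ad (g : GL (Fin n) F) (x : Mat F n) : Ad g⁻¹ (Ad g x) = x := by
  rw [← Ad_mul, inv_mul_cancel, Ad_one]

theorem Ad_Ad_inv (g : GL (Fin n) F) (x : Mat F n) : Ad g (Ad g⁻¹ x) = x := by
  rw [← Ad_mul, mul_inv_cancel, Ad_one]

theorem mem_parabolicLie_one {b : Fin n → ℕ} {x : Mat F n} :
    x ∈ parabolicLie 1 b ↔ ∀ i j, b j < b i → x i j = 0 := by
  change (∀ i j, b j < b i → Ad (1 : GL (Fin n) F)⁻¹ x i j = 0) ↔ _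
  rw [inv_one, Ad_one]

theorem mem_unipLie_one {b : Fin n → ℕ} {x : Mat F n} :
    x ∈ unipLie 1 b ↔ ∀ i j, b j ≤ b i → x i j = 0 := by
  change (∀ i j, b j ≤ b i → Ad (1 : GL (Fin n) F)⁻¹ x i j = 0) ↔ _
  rw [inv_one, Ad_one]

theorem mem_parabolic_iff {h : GL (Fin n) F} {b : Fin n → ℕ} {g : GL (Fin n) F} :
    g ∈ parabolic h b ↔ (g : Mat F n) ∈ parabolicLie h b :=
  Iff.rfl

theorem mem_parabolicLie_iff {h : GL (Fin n) F} {b : Fin n → ℕ} {x : Mat F n} :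
    x ∈ parabolicLie h b ↔ Ad h⁻¹ x ∈ parabolicLie 1 b := by
  rw [mem_parabolicLie_one]; rfl

theorem mem_unipLie_iff {h : GL (Fin n) F} {b : Fin n → ℕ} {x : Mat F n} :
    x ∈ unipLie h b ↔ Ad h⁻¹ x ∈ unipLie 1 b := by
  rw [mem_unipLie_one]; rfl

theorem unipLie_le_parabolicLie (b : Fin n → ℕ) :
    unipLie (1 : GL (Fin n) F) b ≤ parabolicLie 1 b := fun x hx => by
  rw [mem_unipLie_one] at hx
  exact mem_parabolicLie_one.2 fun i j hij => hx i j hij.le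

theorem leviProj_sub_mem {h : GL (Fin n) F} {b : Fin n → ℕ} {x : Mat F n}
    (hx : x ∈ parabolicLie h b) : (leviProj h b x : Mat F n) - x ∈ unipLie h b := by
  intro i j hij
  have e : Ad h⁻¹ ((leviProj h b x : Mat F n) - x) =
      Matrix.of (fun i j => if b i = b j then Ad h⁻¹ x i j else 0) - Ad h⁻¹ x := by
    simp only [leviProj, sub_eq_add_neg, Ad_add, Ad_inv_Ad]
    simp [Ad]
  rw [e]
  by_cases hb : b i = b j
  · simp [hb]
  · simp [hb, hx i j (by omega)]

open Classical in
-- The inner sum runs over a full coset of 𝒰_P, and π_ℒ(z) - z lies in 𝒰_P for z in 𝒫, so a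
-- translation removes the projection. What remains involves P but no Levi subgroup.
theorem hcInd_hcRes_apply [Fintype F] (h : GL (Fin n) F) (b : Fin n → ℕ) (f : invFun F n)
    (x : Mat F n) :
    (hcInd h b (hcRes h b f)).1 x = (Nat.card (parabolic h b) : ℂ)⁻¹ *
      ((Nat.card (unipLie h b) : ℂ)⁻¹ * ∑ g : GL (Fin n) F,
        if Ad g x ∈ parabolicLie h b then ∑ y : unipLie h b, f.1 (Ad g x + y) else 0) := by
  simp only [hcInd, hcRes, LinearMap.coe_mk, AddHom.coe_mk]
  congr 1
  rw [Finset.mul_sum]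
  refine Finset.sum_congr rfl fun g _ => ?_
  split_ifs with hg
  · congr 1
    refine Fintype.sum_equiv (Equiv.addRight ⟨_, leviProj_sub_mem hg⟩) _ _ fun y => ?_
    refine congrArg f.1 ?_
    change (leviProj h b (Ad g x) : Mat F n) + y =
      Ad g x + ((y : Mat F n) + ((leviProj h b (Ad g x) : Mat F n) - Ad g x))
    abel
  · simp

/-- The operator `R ∘ *R` of the standard parabolic subgroup of the labelling `b`. -/
def hcAvg [Fintype F] (b : Fin n → ℕ) : invFun F n →ₗ[ℂ] invFun F n :=
  hcInd 1 b ∘ₗ hcRes 1 b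

open Classical in
theorem hcAvg_apply [Fintype F] (b : Fin n → ℕ) (f : invFun F n) (x : Mat F n) :
    (hcAvg b f).1 x = (Nat.card (parabolic (1 : GL (Fin n) F) b) : ℂ)⁻¹ *
      ((Nat.card (unipLie (1 : GL (Fin n) F) b) : ℂ)⁻¹ * ∑ g : GL (Fin n) F,
        if Ad g x ∈ parabolicLie 1 b then
          ∑ y : unipLie (1 : GL (Fin n) F) b, f.1 (Ad g x + y) else 0) :=
  hcInd_hcRes_apply 1 b f x

/-- Conjugation by `h` identifies the standard nilradical with its conjugate. -/
def unipLieConj (h : GL (Fin n) F) (b : Fin n → ℕ) :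
    unipLie (1 : GL (Fin n) F) b ≃ unipLie h b where
  toFun y := ⟨Ad h y, mem_unipLie_iff.2 (by rw [Ad_inv_Ad]; exact y.2)⟩
  invFun y := ⟨Ad h⁻¹ y, mem_unipLie_iff.1 y.2⟩
  left_inv y := Subtype.ext (Ad_inv_Ad h y)
  right_inv y := Subtype.ext (Ad_Ad_inv h y)

theorem coe_conj (h g : GL (Fin n) F) : ((h * g * h⁻¹ : GL (Fin n) F) : Mat F n) = Ad h g := by
  simp [Ad]

/-- Conjugation by `h` identifies the standard parabolic subgroup with its conjugate. -/
def parabolicConj (h : GL (Fin n) F) (b : Fin n → ℕ) :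
    parabolic (1 : GL (Fin n) F) b ≃ parabolic h b where
  toFun g := ⟨h * g * h⁻¹, by
    rw [mem_parabolic_iff, mem_parabolicLie_iff, coe_conj, Ad_inv_Ad]; exact g.2⟩
  invFun g := ⟨h⁻¹ * g * h, by
    have := coe_conj h⁻¹ (g : GL (Fin n) F)
    rw [inv_inv] at this
    rw [mem_parabolic_iff, this, ← mem_parabolicLie_iff]; exact g.2⟩
  left_inv g := Subtype.ext (by simp [mul_assoc])
  right_inv g := Subtype.ext (by simp [mul_assoc])

/-- Substituting hg for g carries the standard 𝒫 and 𝒰_P to their conjugates, and f does not see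
conjugation by h. This makes every choice of Borel and Levi subgroups irrelevant. -/
theorem hcInd_comp_hcRes [Fintype F] (h : GL (Fin n) F) (b : Fin n → ℕ) :
    hcInd h b ∘ₗ hcRes h b = hcAvg b := by
  classical
  refine LinearMap.ext fun f => Subtype.ext (funext fun x => ?_)
  rw [LinearMap.comp_apply, hcInd_hcRes_apply, hcAvg_apply, Nat.card_congr (parabolicConj h b),
    Nat.card_congr (unipLieConj h b)]
  congr 2
  refine (Fintype.sum_equiv (Equiv.mulLeft h) _ _ fun g => ?_).symm
  have hg : Ad (Equiv.mulLeft h g) x = Ad h (Ad g x) := Ad_mul h g x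
  rw [hg]
  have hmem : Ad h (Ad g x) ∈ parabolicLie h b ↔ Ad g x ∈ parabolicLie 1 b := by
    rw [mem_parabolicLie_iff, Ad_inv_Ad]
  simp only [hmem]
  split_ifs
  · refine Fintype.sum_equiv (unipLieConj h b) _ _ fun y => ?_
    rw [← f.2 h, Ad_add]; rfl
  · rfl

/-- Here P is the whole group and 𝒰_P = 0, so the formula averages the constant f(x) over the group.
The case n = 0 is included. -/
theorem hcAvg_of_const [Fintype F] (b : Fin n → ℕ) (hb : ∀ i j, b i = b j) :
    (hcAvg b : invFun F n →ₗ[ℂ] invFun F n) = LinearMap.id := by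
  classical
  refine LinearMap.ext fun f => Subtype.ext (funext fun x => ?_)
  have hP : ∀ y : Mat F n, y ∈ parabolicLie 1 b := fun y =>
    mem_parabolicLie_one.2 fun i j hij => absurd (hb j i) hij.ne
  have hG : parabolic (1 : GL (Fin n) F) b = ⊤ := by
    ext g; simpa using mem_parabolic_iff.2 (hP g)
  have hU : unipLie (1 : GL (Fin n) F) b = ⊥ := by
    refine (Submodule.eq_bot_iff _).2 fun y hy => ?_
    ext i j
    exact mem_unipLie_one.1 hy i j (hb j i).le
  have hU0 : ∀ y : unipLie (1 : GL (Fin n) F) b, (y : Mat F n) = 0 := fun y => by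
    have := hU.le y.2
    simpa using this
  have hcard : (Nat.card (unipLie (1 : GL (Fin n) F) b)) = 1 := by rw [hU]; simp
  have hcard' : Fintype.card (unipLie (1 : GL (Fin n) F) b) = 1 := by
    rw [← hcard, Nat.card_eq_fintype_card]
  have hf : ∀ g, f.1 (Ad g x) = f.1 x := fun g => f.2 g x
  rw [hcAvg_apply, hcard, hG]
  simp only [hP, hU0, if_true, add_zero, hf]
  simp [hcard']

end Standard

/-! ### Block matrices and concatenated labellings -/

section Blocks

variable {F : Type*} [Field F] {k l : ℕ}

@[simp] theorem twoBlocks_castAdd (i : Fin k) : twoBlocks k (k + l) (Fin.castAdd l i) = 0 := by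
  simp [twoBlocks]

@[simp] theorem twoBlocks_natAdd (i : Fin l) : twoBlocks k (k + l) (Fin.natAdd k i) = 1 := by
  simp [twoBlocks]

omit [Field F] in
theorem topBlock_apply (x : Mat F (k + l)) (i j : Fin k) :
    topBlock rfl x i j = x (Fin.castAdd l i) (Fin.castAdd l j) := rfl

omit [Field F] in
theorem botBlock_apply (x : Mat F (k + l)) (i j : Fin l) :
    botBlock rfl x i j = x (Fin.natAdd k i) (Fin.natAdd k j) := rfl

theorem topBlock_add (x y : Mat F (k + l)) :
    topBlock rfl (x + y) = topBlock rfl x + topBlock rfl y := rfl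

theorem topBlock_sub (x y : Mat F (k + l)) :
    topBlock rfl (x - y) = topBlock rfl x - topBlock rfl y := rfl

theorem botBlock_add (x y : Mat F (k + l)) :
    botBlock rfl (x + y) = botBlock rfl x + botBlock rfl y := rfl

theorem botBlock_sub (x y : Mat F (k + l)) :
    botBlock rfl (x - y) = botBlock rfl x - botBlock rfl y := rfl

section blockDiag

variable (x : Mat F k) (y : Mat F l)

@[simp] theorem blockDiag_castAdd_castAdd (i j : Fin k) :
    (blockDiag (n := k + l) rfl x y).1 (Fin.castAdd l i) (Fin.castAdd l j) = x i j := by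
  simp [blockDiag]

@[simp] theorem blockDiag_natAdd_natAdd (i j : Fin l) :
    (blockDiag (n := k + l) rfl x y).1 (Fin.natAdd k i) (Fin.natAdd k j) = y i j := by
  simp [blockDiag]

@[simp] theorem blockDiag_castAdd_natAdd (i : Fin k) (j : Fin l) :
    (blockDiag (n := k + l) rfl x y).1 (Fin.castAdd l i) (Fin.natAdd k j) = 0 := by
  simp [blockDiag]

@[simp] theorem blockDiag_natAdd_castAdd (i : Fin l) (j : Fin k) :
    (blockDiag (n := k + l) rfl x y).1 (Fin.natAdd k i) (Fin.castAdd l j) = 0 := by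
  simp [blockDiag]

@[simp] theorem topBlock_blockDiag : topBlock rfl (blockDiag (n := k + l) rfl x y).1 = x := by
  ext i j; simp [topBlock_apply]

@[simp] theorem botBlock_blockDiag : botBlock rfl (blockDiag (n := k + l) rfl x y).1 = y := by
  ext i j; simp [botBlock_apply]

theorem blockDiag_add (x' : Mat F k) (y' : Mat F l) :
    (blockDiag (n := k + l) rfl (x + x') (y + y')).1 =
      (blockDiag rfl x y).1 + (blockDiag rfl x' y').1 := by
  refine Matrix.ext (Fin.addCases (fun i => Fin.addCases ?_ ?_) (fun i => Fin.addCases ?_ ?_)) <;>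
    simp

end blockDiag

theorem forall_fin_add {p : Fin (k + l) → Prop} :
    (∀ i, p i) ↔ (∀ i, p (Fin.castAdd l i)) ∧ ∀ i, p (Fin.natAdd k i) :=
  ⟨fun h => ⟨fun _ => h _, fun _ => h _⟩, fun h i => Fin.addCases h.1 h.2 i⟩

theorem mem_parabolicLie_twoBlocks {x : Mat F (k + l)} :
    x ∈ parabolicLie 1 (twoBlocks k (k + l)) ↔
      ∀ i j, x (Fin.natAdd k i) (Fin.castAdd l j) = 0 := by
  simp [mem_parabolicLie_one, forall_fin_add]

theorem mem_unipLie_twoBlocks {x : Mat F (k + l)} :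
    x ∈ unipLie 1 (twoBlocks k (k + l)) ↔
      x ∈ parabolicLie 1 (twoBlocks k (k + l)) ∧ topBlock rfl x = 0 ∧ botBlock rfl x = 0 := by
  simp only [mem_parabolicLie_twoBlocks, mem_unipLie_one, forall_fin_add, twoBlocks_castAdd,
    twoBlocks_natAdd, ← Matrix.ext_iff, topBlock_apply, botBlock_apply, Matrix.zero_apply]
  simp [forall_and]
  tauto

theorem blockDiag_mem_parabolicLie (x : Mat F k) (y : Mat F l) :
    (blockDiag (n := k + l) rfl x y).1 ∈ parabolicLie 1 (twoBlocks k (k + l)) :=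
  mem_parabolicLie_twoBlocks.2 fun i j => by simp

theorem sub_blockDiag_mem {x : Mat F (k + l)} (hx : x ∈ parabolicLie 1 (twoBlocks k (k + l))) :
    x - (blockDiag rfl (topBlock rfl x) (botBlock rfl x)).1 ∈
      unipLie 1 (twoBlocks k (k + l)) := by
  refine mem_unipLie_twoBlocks.2
    ⟨Submodule.sub_mem _ hx (blockDiag_mem_parabolicLie _ _), ?_, ?_⟩
  · ext i j; simp [topBlock_apply]
  · ext i j; simp [botBlock_apply]

theorem leviProj_twoBlocks (x : Mat F (k + l)) :
    (leviProj 1 (twoBlocks k (k + l)) x : Mat F (k + l)) =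
      Matrix.of fun i j => if twoBlocks k (k + l) i = twoBlocks k (k + l) j then x i j else 0 := by
  simp [leviProj, Ad_one]

@[simp] theorem topBlock_leviProj (x : Mat F (k + l)) :
    topBlock rfl (leviProj 1 (twoBlocks k (k + l)) x).1 = topBlock rfl x := by
  ext i j; simp [topBlock_apply, leviProj_twoBlocks]

@[simp] theorem botBlock_leviProj (x : Mat F (k + l)) :
    botBlock rfl (leviProj 1 (twoBlocks k (k + l)) x).1 = botBlock rfl x := by
  ext i j; simp [botBlock_apply, leviProj_twoBlocks]

section Conjugation

variable (g : GL (Fin k) F) (h : GL (Fin l) F) {x : Mat F (k + l)}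

/-- Split x into its block diagonal part and a nilradical part: conjugation by L acts blockwise on
the first and preserves the second. -/
theorem Ad_blockGL_sub_mem (hx : x ∈ parabolicLie 1 (twoBlocks k (k + l))) :
    Ad (blockGL rfl g h) x -
      (blockDiag rfl (Ad g (topBlock rfl x)) (Ad h (botBlock rfl x))).1 ∈
        unipLie 1 (twoBlocks k (k + l)) := by
  have e : Ad (blockGL rfl g h) x =
      (blockDiag rfl (Ad g (topBlock rfl x)) (Ad h (botBlock rfl x))).1 +
        Ad (blockGL rfl g h) (x - (blockDiag rfl (topBlock rfl x) (botBlock rfl x)).1) := by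
    rw [← Ad_blockGL, ← Ad_add, add_sub_cancel]
  rw [e, add_sub_cancel_left]
  exact Ad_blockGL_mem rfl g h (sub_blockDiag_mem hx)

theorem Ad_blockGL_mem_parabolicLie (hx : x ∈ parabolicLie 1 (twoBlocks k (k + l))) :
    Ad (blockGL rfl g h) x ∈ parabolicLie 1 (twoBlocks k (k + l)) := by
  have := Submodule.add_mem _ (unipLie_le_parabolicLie _ (Ad_blockGL_sub_mem g h hx))
    (blockDiag_mem_parabolicLie (Ad g (topBlock rfl x)) (Ad h (botBlock rfl x)))
  rwa [sub_add_cancel] at this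

theorem blockGL_inv : (blockGL (n := k + l) rfl g h)⁻¹ = blockGL rfl g⁻¹ h⁻¹ :=
  Units.ext rfl

theorem Ad_blockGL_mem_parabolicLie_iff :
    Ad (blockGL rfl g h) x ∈ parabolicLie 1 (twoBlocks k (k + l)) ↔
      x ∈ parabolicLie 1 (twoBlocks k (k + l)) := by
  refine ⟨fun hx => ?_, Ad_blockGL_mem_parabolicLie g h⟩
  have := Ad_blockGL_mem_parabolicLie g⁻¹ h⁻¹ hx
  rwa [← blockGL_inv, Ad_inv_Ad] at this

theorem topBlock_Ad_blockGL (hx : x ∈ parabolicLie 1 (twoBlocks k (k + l))) :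
    topBlock rfl (Ad (blockGL rfl g h) x) = Ad g (topBlock rfl x) := by
  have := (mem_unipLie_twoBlocks.1 (Ad_blockGL_sub_mem g h hx)).2.1
  rwa [topBlock_sub, topBlock_blockDiag, sub_eq_zero] at this

theorem botBlock_Ad_blockGL (hx : x ∈ parabolicLie 1 (twoBlocks k (k + l))) :
    botBlock rfl (Ad (blockGL rfl g h) x) = Ad h (botBlock rfl x) := by
  have := (mem_unipLie_twoBlocks.1 (Ad_blockGL_sub_mem g h hx)).2.2
  rwa [botBlock_sub, botBlock_blockDiag, sub_eq_zero] at this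

end Conjugation

/-- The labelling `b` of `k + l` coordinates is, up to order isomorphism of the labels, the
concatenation of `b₁` and `b₂`. -/
structure IsConcat (b : Fin (k + l) → ℕ) (b₁ : Fin k → ℕ) (b₂ : Fin l → ℕ) : Prop where
  left : ∀ i j, b (Fin.castAdd l i) < b (Fin.castAdd l j) ↔ b₁ i < b₁ j
  right : ∀ i j, b (Fin.natAdd k i) < b (Fin.natAdd k j) ↔ b₂ i < b₂ j
  left_lt_right : ∀ i j, b (Fin.castAdd l i) < b (Fin.natAdd k j)

namespace IsConcat

variable {b : Fin (k + l) → ℕ} {b₁ : Fin k → ℕ} {b₂ : Fin l → ℕ} (hb : IsConcat b b₁ b₂)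
include hb

theorem mem_parabolicLie {x : Mat F (k + l)} :
    x ∈ parabolicLie 1 b ↔ x ∈ parabolicLie 1 (twoBlocks k (k + l)) ∧
      topBlock rfl x ∈ parabolicLie 1 b₁ ∧ botBlock rfl x ∈ parabolicLie 1 b₂ := by
  have h1 : ∀ i j, ¬ b (Fin.natAdd k j) < b (Fin.castAdd l i) :=
    fun i j => (hb.left_lt_right i j).not_gt
  simp only [mem_parabolicLie_one, forall_fin_add, hb.left, hb.right,
    hb.left_lt_right, h1, topBlock_apply, botBlock_apply]
  simp [forall_and]
  tauto

theorem mem_unipLie {x : Mat F (k + l)} :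
    x ∈ unipLie 1 b ↔ x ∈ parabolicLie 1 (twoBlocks k (k + l)) ∧
      topBlock rfl x ∈ unipLie 1 b₁ ∧ botBlock rfl x ∈ unipLie 1 b₂ := by
  simp only [mem_parabolicLie_twoBlocks, mem_unipLie_one, forall_fin_add, ← not_lt, hb.left,
    hb.right, hb.left_lt_right, (hb.left_lt_right _ _).not_gt, topBlock_apply, botBlock_apply]
  simp [forall_and]
  tauto

/-- The nilradical of `b` is assembled from its two diagonal blocks and the upper right block. -/
def unipLieEquiv : (unipLie (1 : GL (Fin k) F) b₁ × unipLie (1 : GL (Fin l) F) b₂) ×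
    unipLie (1 : GL (Fin (k + l)) F) (twoBlocks k (k + l)) ≃
      unipLie (1 : GL (Fin (k + l)) F) b where
  toFun p := ⟨(blockDiag rfl p.1.1.1 p.1.2.1).1 + p.2.1, by
    obtain ⟨h1, h2, h3⟩ := mem_unipLie_twoBlocks.1 p.2.2
    refine hb.mem_unipLie.2 ⟨Submodule.add_mem _ (blockDiag_mem_parabolicLie _ _) h1, ?_, ?_⟩
    · rw [topBlock_add, h2, topBlock_blockDiag, add_zero]; exact p.1.1.2
    · rw [botBlock_add, h3, botBlock_blockDiag, add_zero]; exact p.1.2.2⟩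
  invFun w := ⟨⟨⟨topBlock rfl w.1, (hb.mem_unipLie.1 w.2).2.1⟩,
    ⟨botBlock rfl w.1, (hb.mem_unipLie.1 w.2).2.2⟩⟩,
    ⟨_, sub_blockDiag_mem (hb.mem_unipLie.1 w.2).1⟩⟩
  left_inv p := by
    obtain ⟨h1, h2, h3⟩ := mem_unipLie_twoBlocks.1 p.2.2
    have e1 : topBlock rfl ((blockDiag rfl p.1.1.1 p.1.2.1).1 + p.2.1) = p.1.1.1 := by
      rw [topBlock_add, h2, topBlock_blockDiag, add_zero]
    have e2 : botBlock rfl ((blockDiag rfl p.1.1.1 p.1.2.1).1 + p.2.1) = p.1.2.1 := by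
      rw [botBlock_add, h3, botBlock_blockDiag, add_zero]
    refine Prod.ext (Prod.ext (Subtype.ext e1) (Subtype.ext e2)) (Subtype.ext ?_)
    simp only [e1, e2, add_sub_cancel_left]
  right_inv w := Subtype.ext (add_sub_cancel _ _)

theorem card_unipLie :
    Nat.card (unipLie (1 : GL (Fin (k + l)) F) b) =
      Nat.card (unipLie (1 : GL (Fin k) F) b₁) * Nat.card (unipLie (1 : GL (Fin l) F) b₂) *
        Nat.card (unipLie (1 : GL (Fin (k + l)) F) (twoBlocks k (k + l))) := by
  rw [← Nat.card_congr (unipLieEquiv hb), Nat.card_prod, Nat.card_prod]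

open Classical in
-- The upper right block of z is absorbed by translating the summation variable `u`, so only the
-- diagonal blocks of z remain.
theorem sum_unipLie [Fintype F] (f : Mat F (k + l) → ℂ) {z : Mat F (k + l)}
    (hz : z ∈ parabolicLie 1 (twoBlocks k (k + l))) :
    ∑ w : unipLie (1 : GL (Fin (k + l)) F) b, f (z + w) =
      ∑ u₁ : unipLie (1 : GL (Fin k) F) b₁, ∑ u₂ : unipLie (1 : GL (Fin l) F) b₂,
        ∑ u : unipLie (1 : GL (Fin (k + l)) F) (twoBlocks k (k + l)),
          f ((blockDiag rfl (topBlock rfl z + u₁.1) (botBlock rfl z + u₂.1)).1 + u.1) := by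
  rw [← Fintype.sum_prod_type', ← Fintype.sum_prod_type']
  refine (Fintype.sum_equiv (((Equiv.refl _).prodCongr
    (Equiv.addRight (-⟨_, sub_blockDiag_mem hz⟩))).trans (unipLieEquiv hb)) _ _ fun p => ?_).symm
  refine congrArg f ?_
  change _ = z + ((blockDiag rfl p.1.1.1 p.1.2.1).1 + (p.2.1 +
    -(z - (blockDiag rfl (topBlock rfl z) (botBlock rfl z)).1)))
  rw [blockDiag_add]
  abel

end IsConcat

/-! ### Orders of parabolic subgroups -/

theorem topBlock_mul {x y : Mat F (k + l)} (hy : y ∈ parabolicLie 1 (twoBlocks k (k + l))) :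
    topBlock rfl (x * y) = topBlock rfl x * topBlock rfl y := by
  ext i j
  simp [topBlock_apply, Matrix.mul_apply, Fin.sum_univ_add, mem_parabolicLie_twoBlocks.1 hy]

theorem botBlock_mul {x y : Mat F (k + l)} (hx : x ∈ parabolicLie 1 (twoBlocks k (k + l))) :
    botBlock rfl (x * y) = botBlock rfl x * botBlock rfl y := by
  ext i j
  simp [botBlock_apply, Matrix.mul_apply, Fin.sum_univ_add, mem_parabolicLie_twoBlocks.1 hx]

variable (F k l) in
/-- The projection `P_{k,l} → GLₖ(F) × GLₗ(F)` to the diagonal blocks. -/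
def diagonalBlocks :
    parabolic (1 : GL (Fin (k + l)) F) (twoBlocks k (k + l)) →* GL (Fin k) F × GL (Fin l) F :=
  (MonoidHom.toHomUnits
    { toFun := fun g => topBlock rfl (g.1 : Mat F (k + l))
      map_one' := by ext i j; simp [topBlock_apply, Matrix.one_apply]
      map_mul' := fun g h => topBlock_mul h.2 }).prod
  (MonoidHom.toHomUnits
    { toFun := fun g => botBlock rfl (g.1 : Mat F (k + l))
      map_one' := by ext i j; simp [botBlock_apply, Matrix.one_apply]
      map_mul' := fun g h => botBlock_mul g.2 })

theorem diagonalBlocks_surjective : Function.Surjective (diagonalBlocks F k l) := fun p =>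
  ⟨⟨blockGL rfl p.1 p.2, blockDiag_mem_parabolicLie _ _⟩,
    Prod.ext (Units.ext (topBlock_blockDiag _ _)) (Units.ext (botBlock_blockDiag _ _))⟩

/-- P_b is the preimage of P_{b₁} × P_{b₂} under the surjection of P_{k,l} onto GLₖ × GLₗ, so the
two indices agree. The identity is stated without division. -/
theorem IsConcat.card_parabolic [Fintype F] {b : Fin (k + l) → ℕ} {b₁ : Fin k → ℕ}
    {b₂ : Fin l → ℕ} (hb : IsConcat b b₁ b₂) :
    Nat.card (parabolic (1 : GL (Fin (k + l)) F) b) *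
        (Nat.card (GL (Fin k) F) * Nat.card (GL (Fin l) F)) =
      Nat.card (parabolic (1 : GL (Fin (k + l)) F) (twoBlocks k (k + l))) *
        (Nat.card (parabolic (1 : GL (Fin k) F) b₁) *
          Nat.card (parabolic (1 : GL (Fin l) F) b₂)) := by
  have hle : parabolic (1 : GL (Fin (k + l)) F) b ≤ parabolic 1 (twoBlocks k (k + l)) :=
    fun g hg => (hb.mem_parabolicLie.1 hg).1
  have hcomap : (parabolic (1 : GL (Fin (k + l)) F) b).subgroupOf
      (parabolic 1 (twoBlocks k (k + l))) =
      ((parabolic (1 : GL (Fin k) F) b₁).prod (parabolic (1 : GL (Fin l) F) b₂)).comap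
        (diagonalBlocks F k l) := by
    ext g
    exact hb.mem_parabolicLie.trans (and_iff_right g.2)
  have h1 := (parabolic (1 : GL (Fin k) F) b₁).card_mul_index
  have h2 := (parabolic (1 : GL (Fin l) F) b₂).card_mul_index
  have h3 := ((parabolic (1 : GL (Fin (k + l)) F) b).subgroupOf
      (parabolic 1 (twoBlocks k (k + l)))).card_mul_index
  rw [Nat.card_congr (Subgroup.subgroupOfEquivOfLe hle).toEquiv, hcomap,
    Subgroup.index_comap_of_surjective _ diagonalBlocks_surjective, Subgroup.index_prod] at h3
  rw [← h1, ← h2, ← h3]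
  ring

end Blocks

/-! ### Transitivity of induction and restriction -/

section Transitivity

variable {F : Type*} [Field F] [Fintype F] {k l : ℕ}

@[simp] theorem boxTensor_comulComp {n : ℕ} (hn : k + l = n) (f : invFun F n) :
    boxTensor F k l (comulComp F hn f) = resProd F hn f :=
  (boxEquiv F k l).apply_symm_apply _

open Classical in
theorem resProd_apply (f : invFun F (k + l)) (x : Mat F k) (y : Mat F l) :
    (resProd F rfl f).1 (x, y) =
      (Nat.card (unipLie (1 : GL (Fin (k + l)) F) (twoBlocks k (k + l))) : ℂ)⁻¹ *
        ∑ u : unipLie (1 : GL (Fin (k + l)) F) (twoBlocks k (k + l)),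
          f.1 ((blockDiag rfl x y).1 + u) :=
  rfl

open Classical in
theorem mulComp_apply (t : invFun F k ⊗[ℂ] invFun F l) (x : Mat F (k + l)) :
    (mulComp F rfl t).1 x =
      (Nat.card (parabolic (1 : GL (Fin (k + l)) F) (twoBlocks k (k + l))) : ℂ)⁻¹ *
        ∑ g : GL (Fin (k + l)) F, if Ad g x ∈ parabolicLie 1 (twoBlocks k (k + l)) then
          (boxTensor F k l t).1 (topBlock rfl (Ad g x), botBlock rfl (Ad g x)) else 0 := by
  have h : ∀ z, toLevi F rfl (boxTensor F k l t) (leviProj 1 (twoBlocks k (k + l)) z) =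
      (boxTensor F k l t).1 (topBlock rfl z, botBlock rfl z) := fun z => by
    rw [← topBlock_leviProj, ← botBlock_leviProj]; rfl
  simp only [← h]
  rfl

open Classical in
-- Both sides are additive in t, and on pure tensors the sums factor. General t is needed because
-- `comulComp` need not produce pure tensors.
theorem boxTensor_map_hcAvg (b₁ : Fin k → ℕ) (b₂ : Fin l → ℕ) (t : invFun F k ⊗[ℂ] invFun F l)
    (x : Mat F k) (y : Mat F l) :
    (boxTensor F k l (TensorProduct.map (hcAvg b₁) (hcAvg b₂) t)).1 (x, y) =
      ((Nat.card (parabolic (1 : GL (Fin k) F) b₁) : ℂ)⁻¹ *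
        (Nat.card (unipLie (1 : GL (Fin k) F) b₁) : ℂ)⁻¹) *
      ((Nat.card (parabolic (1 : GL (Fin l) F) b₂) : ℂ)⁻¹ *
        (Nat.card (unipLie (1 : GL (Fin l) F) b₂) : ℂ)⁻¹) *
      ∑ g : GL (Fin k) F, ∑ h : GL (Fin l) F,
        if Ad g x ∈ parabolicLie 1 b₁ ∧ Ad h y ∈ parabolicLie 1 b₂ then
          ∑ u₁ : unipLie (1 : GL (Fin k) F) b₁, ∑ u₂ : unipLie (1 : GL (Fin l) F) b₂,
            (boxTensor F k l t).1 (Ad g x + u₁, Ad h y + u₂) else 0 := by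
  induction t with
  | zero => simp
  | add s t hs ht =>
    have hadd : ∀ (p q : invFun F k ⊗[ℂ] invFun F l) z, (boxTensor F k l (p + q)).1 z =
        (boxTensor F k l p).1 z + (boxTensor F k l q).1 z := fun p q z => by
      rw [map_add]; rfl
    simp only [map_add] at hs ht ⊢
    rw [← map_add, hadd, hs, ht, ← mul_add, ← Finset.sum_add_distrib]
    simp only [← map_add, hadd, ← Finset.sum_add_distrib, ite_add_ite, add_zero]
  | tmul f₁ f₂ =>
    rw [TensorProduct.map_tmul, boxTensor_tmul, hcAvg_apply, hcAvg_apply]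
    have h : ∀ (g : GL (Fin k) F) (h : GL (Fin l) F),
        (if Ad g x ∈ parabolicLie 1 b₁ ∧ Ad h y ∈ parabolicLie 1 b₂ then
          ∑ u₁ : unipLie (1 : GL (Fin k) F) b₁, ∑ u₂ : unipLie (1 : GL (Fin l) F) b₂,
            (boxTensor F k l (f₁ ⊗ₜ[ℂ] f₂)).1 (Ad g x + u₁, Ad h y + u₂) else 0) =
        (if Ad g x ∈ parabolicLie 1 b₁ then
          ∑ u₁ : unipLie (1 : GL (Fin k) F) b₁, f₁.1 (Ad g x + u₁) else 0) *
        (if Ad h y ∈ parabolicLie 1 b₂ then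
          ∑ u₂ : unipLie (1 : GL (Fin l) F) b₂, f₂.1 (Ad h y + u₂) else 0) := by
      intro g h
      rw [ite_zero_mul_ite_zero, Finset.sum_mul_sum]
      rfl
    simp only [h, ← Finset.mul_sum, ← Finset.sum_mul]
    ring

theorem card_parabolic_ne_zero {n : ℕ} (b : Fin n → ℕ) :
    (Nat.card (parabolic (1 : GL (Fin n) F) b) : ℂ) ≠ 0 :=
  Nat.cast_ne_zero.2 Nat.card_pos.ne'

/-- Transitivity of Harish-Chandra induction and restriction. -/
theorem IsConcat.hcAvg_eq {b : Fin (k + l) → ℕ} {b₁ : Fin k → ℕ} {b₂ : Fin l → ℕ}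
    (hb : IsConcat b b₁ b₂) :
    (hcAvg b : invFun F (k + l) →ₗ[ℂ] _) =
      mulComp F rfl ∘ₗ TensorProduct.map (hcAvg b₁) (hcAvg b₂) ∘ₗ comulComp F rfl := by
  classical
  refine LinearMap.ext fun f => Subtype.ext (funext fun x => ?_)
  rw [LinearMap.comp_apply, LinearMap.comp_apply, mulComp_apply, hcAvg_apply]
  simp only [boxTensor_map_hcAvg, boxTensor_comulComp, resProd_apply]
  -- `A g` is the summand of the left side. The right summand at g will be a weighted sum of A over
  -- the translates of g by the Levi subgroup.
  set A : GL (Fin (k + l)) F → ℂ := fun g =>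
    if Ad g x ∈ parabolicLie 1 b then
      ∑ w : unipLie (1 : GL (Fin (k + l)) F) b, f.1 (Ad g x + w) else 0 with hA
  have key : ∀ g : GL (Fin (k + l)) F,
      (if Ad g x ∈ parabolicLie 1 (twoBlocks k (k + l)) then
        ((Nat.card (parabolic (1 : GL (Fin k) F) b₁) : ℂ)⁻¹ *
          (Nat.card (unipLie (1 : GL (Fin k) F) b₁) : ℂ)⁻¹) *
        ((Nat.card (parabolic (1 : GL (Fin l) F) b₂) : ℂ)⁻¹ *
          (Nat.card (unipLie (1 : GL (Fin l) F) b₂) : ℂ)⁻¹) *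
        ∑ g₁ : GL (Fin k) F, ∑ g₂ : GL (Fin l) F,
          if Ad g₁ (topBlock rfl (Ad g x)) ∈ parabolicLie 1 b₁ ∧
              Ad g₂ (botBlock rfl (Ad g x)) ∈ parabolicLie 1 b₂ then
            ∑ u₁ : unipLie (1 : GL (Fin k) F) b₁, ∑ u₂ : unipLie (1 : GL (Fin l) F) b₂,
              (Nat.card (unipLie (1 : GL (Fin (k + l)) F) (twoBlocks k (k + l))) : ℂ)⁻¹ *
                ∑ u : unipLie (1 : GL (Fin (k + l)) F) (twoBlocks k (k + l)),
                  f.1 ((blockDiag rfl (Ad g₁ (topBlock rfl (Ad g x)) + u₁.1)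
                    (Ad g₂ (botBlock rfl (Ad g x)) + u₂.1)).1 + u.1) else 0 else 0) =
      ((Nat.card (parabolic (1 : GL (Fin k) F) b₁) : ℂ)⁻¹ *
          (Nat.card (parabolic (1 : GL (Fin l) F) b₂) : ℂ)⁻¹ *
          (Nat.card (unipLie (1 : GL (Fin (k + l)) F) b) : ℂ)⁻¹) *
        ∑ g₁ : GL (Fin k) F, ∑ g₂ : GL (Fin l) F, A (blockGL rfl g₁ g₂ * g) := by
    intro g
    by_cases hg : Ad g x ∈ parabolicLie 1 (twoBlocks k (k + l))
    · have hAg : ∀ g₁ g₂, A (blockGL rfl g₁ g₂ * g) =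
          if Ad g₁ (topBlock rfl (Ad g x)) ∈ parabolicLie 1 b₁ ∧
              Ad g₂ (botBlock rfl (Ad g x)) ∈ parabolicLie 1 b₂ then
            ∑ u₁ : unipLie (1 : GL (Fin k) F) b₁, ∑ u₂ : unipLie (1 : GL (Fin l) F) b₂,
              ∑ u : unipLie (1 : GL (Fin (k + l)) F) (twoBlocks k (k + l)),
                f.1 ((blockDiag rfl (Ad g₁ (topBlock rfl (Ad g x)) + u₁.1)
                  (Ad g₂ (botBlock rfl (Ad g x)) + u₂.1)).1 + u.1) else 0 := by
        intro g₁ g₂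
        have hγ := Ad_blockGL_mem_parabolicLie g₁ g₂ hg
        simp only [hA, Ad_mul]
        rw [hb.sum_unipLie f.1 hγ, topBlock_Ad_blockGL g₁ g₂ hg, botBlock_Ad_blockGL g₁ g₂ hg]
        refine if_congr ?_ rfl rfl
        rw [hb.mem_parabolicLie, topBlock_Ad_blockGL g₁ g₂ hg, botBlock_Ad_blockGL g₁ g₂ hg]
        exact and_iff_right hγ
      rw [if_pos hg]
      simp only [hAg, hb.card_unipLie, Nat.cast_mul, mul_inv, ← Finset.mul_sum, ← mul_ite_zero]
      ring
    -- 𝒫_b lies in 𝒫_{k,l}, which is stable under conjugation by the Levi subgroup, so both sides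
    -- vanish.
    · rw [if_neg hg]
      have : ∀ g₁ g₂, A (blockGL rfl g₁ g₂ * g) = 0 := fun g₁ g₂ => by
        refine if_neg fun h => hg ?_
        rw [Ad_mul] at h
        exact (Ad_blockGL_mem_parabolicLie_iff g₁ g₂).1 (hb.mem_parabolicLie.1 h).1
      simp [this]
  -- Left translation permutes the group, so each pair (g₁, g₂) contributes the same total.
  have hsum : ∑ g : GL (Fin (k + l)) F, ∑ g₁ : GL (Fin k) F, ∑ g₂ : GL (Fin l) F,
      A (blockGL rfl g₁ g₂ * g) =
        (Nat.card (GL (Fin k) F) * Nat.card (GL (Fin l) F) : ℂ) * ∑ g, A g := by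
    rw [Finset.sum_comm]
    have h1 : ∀ g₁ : GL (Fin k) F, ∑ g : GL (Fin (k + l)) F, ∑ g₂ : GL (Fin l) F,
        A (blockGL rfl g₁ g₂ * g) = (Nat.card (GL (Fin l) F) : ℂ) * ∑ g, A g := fun g₁ => by
      have h2 : ∀ g₂ : GL (Fin l) F, ∑ g, A (blockGL rfl g₁ g₂ * g) = ∑ g, A g := fun g₂ =>
        Equiv.sum_comp (Equiv.mulLeft (blockGL rfl g₁ g₂)) A
      rw [Finset.sum_comm]
      simp [h2]
    simp only [h1]
    simp [mul_assoc]
  rw [Finset.sum_congr rfl fun g _ => key g, ← Finset.mul_sum, hsum]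
  have hc := congrArg (Nat.cast : ℕ → ℂ) (hb.card_parabolic (F := F))
  push_cast at hc
  have h0 := card_parabolic_ne_zero (F := F) b
  have h1 := card_parabolic_ne_zero (F := F) b₁
  have h2 := card_parabolic_ne_zero (F := F) b₂
  have h3 := card_parabolic_ne_zero (F := F) (twoBlocks k (k + l))
  -- The order formula solved for 1/|P_b|: the factor |GLₖ||GLₗ| is exactly the overcount in `hsum`.
  have hc' : (Nat.card (parabolic (1 : GL (Fin (k + l)) F) b) : ℂ)⁻¹ =
      (Nat.card (parabolic (1 : GL (Fin (k + l)) F) (twoBlocks k (k + l))) : ℂ)⁻¹ *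
        ((Nat.card (parabolic (1 : GL (Fin k) F) b₁) : ℂ)⁻¹ *
          (Nat.card (parabolic (1 : GL (Fin l) F) b₂) : ℂ)⁻¹) *
        (Nat.card (GL (Fin k) F) * Nat.card (GL (Fin l) F)) := by
    field_simp
    linear_combination -hc
  rw [hc']
  ring

end Transitivity

/-! ### Compositions -/

section Compositions

variable {n k l : ℕ}

/-- The intervals between consecutive partial sums are disjoint, so block labels can be found by
comparing partial sums. -/
theorem compBlocks_eq {c : Composition n} {i : Fin n} {m : ℕ} (h₁ : c.sizeUpTo m ≤ i)
    (h₂ : (i : ℕ) < c.sizeUpTo (m + 1)) : compBlocks c i = m := by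
  have h3 := c.sizeUpTo_index_le i
  have h4 := c.lt_sizeUpTo_index_succ i
  rcases lt_trichotomy (c.index i : ℕ) m with h | h | h
  · exact absurd (h4.trans_le (c.monotone_sizeUpTo h)) h₁.not_gt
  · exact h
  · exact absurd (h₂.trans_le (c.monotone_sizeUpTo h)) h3.not_gt

theorem sizeUpTo_append_left (c₁ : Composition k) (c₂ : Composition l) {m : ℕ}
    (hm : m ≤ c₁.length) : (c₁.append c₂).sizeUpTo m = c₁.sizeUpTo m := by
  simp [Composition.sizeUpTo, List.take_append_of_le_length (show m ≤ c₁.blocks.length from hm)]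

theorem sizeUpTo_append_right (c₁ : Composition k) (c₂ : Composition l) (m : ℕ) :
    (c₁.append c₂).sizeUpTo (c₁.length + m) = k + c₂.sizeUpTo m := by
  simp [Composition.sizeUpTo, Composition.length, List.take_append,
    List.take_of_length_le (show c₁.blocks.length ≤ c₁.blocks.length + m by omega)]

theorem compBlocks_append_castAdd (c₁ : Composition k) (c₂ : Composition l) (i : Fin k) :
    compBlocks (c₁.append c₂) (Fin.castAdd l i) = compBlocks c₁ i := by
  have h := (c₁.index i).2
  apply compBlocks_eq
  · rw [compBlocks, sizeUpTo_append_left _ _ h.le]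
    exact c₁.sizeUpTo_index_le i
  · rw [compBlocks, sizeUpTo_append_left _ _ h]
    exact c₁.lt_sizeUpTo_index_succ i

theorem compBlocks_append_natAdd (c₁ : Composition k) (c₂ : Composition l) (i : Fin l) :
    compBlocks (c₁.append c₂) (Fin.natAdd k i) = c₁.length + compBlocks c₂ i := by
  apply compBlocks_eq
  · rw [compBlocks, sizeUpTo_append_right]
    exact Nat.add_le_add_left (c₂.sizeUpTo_index_le i) k
  · rw [compBlocks, add_assoc, sizeUpTo_append_right]
    exact Nat.add_lt_add_left (c₂.lt_sizeUpTo_index_succ i) k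

theorem isConcat_append (c₁ : Composition k) (c₂ : Composition l) :
    IsConcat (compBlocks (c₁.append c₂)) (compBlocks c₁) (compBlocks c₂) where
  left i j := by simp only [compBlocks_append_castAdd]
  right i j := by simp only [compBlocks_append_natAdd, Nat.add_lt_add_iff_left]
  left_lt_right i j := by
    rw [compBlocks_append_castAdd, compBlocks_append_natAdd]
    exact Nat.lt_add_right _ (c₁.index i).2

theorem compBlocks_const_of_length_le_one {c : Composition n} (hc : c.length ≤ 1) (i j : Fin n) :
    compBlocks c i = compBlocks c j := by
  have hi := (c.index i).2
  have hj := (c.index j).2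
  simp only [compBlocks]
  omega

/-- Compositions of `k + l` with last block `l` are compositions of `k`. -/
theorem sum_append_single {M : Type*} [AddCommMonoid M] (hl : 0 < l)
    (G : Composition (k + l) → M) :
    ∑ c : Composition k, G (c.append (Composition.single l hl)) =
      ∑ c : Composition (k + l), if c.blocks.getLast? = some l then G c else 0 := by
  rw [← Finset.sum_filter]
  refine Finset.sum_bij (fun c _ => c.append (Composition.single l hl)) ?_ ?_ ?_ ?_
  · simp
  · intro c _ c' _ h
    have := congrArg Composition.blocks h
    exact Composition.ext (by simpa using this)
  · intro c hc
    obtain ⟨ys, hys⟩ := List.getLast?_eq_some_iff.1 (Finset.mem_filter.1 hc).2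
    have hs := c.blocks_sum
    rw [hys, List.sum_append_nat, List.sum_singleton] at hs
    exact ⟨⟨ys, fun hi => c.blocks_pos (by rw [hys]; exact List.mem_append_left _ hi), by omega⟩,
      Finset.mem_univ _, Composition.ext (by simp [hys])⟩
  · intros; rfl

/-- Compositions of `k + l` with first block `k` are compositions of `l`. -/
theorem sum_single_append {M : Type*} [AddCommMonoid M] (hk : 0 < k)
    (G : Composition (k + l) → M) :
    ∑ c : Composition l, G ((Composition.single k hk).append c) =
      ∑ c : Composition (k + l), if c.blocks.head? = some k then G c else 0 := by
  rw [← Finset.sum_filter]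
  refine Finset.sum_bij (fun c _ => (Composition.single k hk).append c) ?_ ?_ ?_ ?_
  · simp
  · intro c _ c' _ h
    have := congrArg Composition.blocks h
    exact Composition.ext (by simpa using this)
  · intro c hc
    obtain ⟨ys, hys⟩ := List.head?_eq_some_iff.1 (Finset.mem_filter.1 hc).2
    have hs := c.blocks_sum
    rw [hys, List.sum_cons] at hs
    exact ⟨⟨ys, fun hi => c.blocks_pos (by rw [hys]; exact List.mem_cons_of_mem _ hi), by omega⟩,
      Finset.mem_univ _, Composition.ext (by simp [hys])⟩
  · intros; rfl

/-- After the sums are exchanged, this counts a composition at the one pair matching its first block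
(`o` being `head?`), and the empty composition at none. -/
theorem sum_antidiagonal_fst_eq {M : Type*} [AddCommMonoid M] (o : Option ℕ)
    (ho : ∀ m ∈ o, m ≤ n) (a : M) :
    ∑ p : {p : ℕ × ℕ // p ∈ Finset.HasAntidiagonal.antidiagonal n},
      (if o = some p.1.1 then a else 0) = if o.isSome then a else 0 := by
  rw [Finset.sum_coe_sort _ fun p : ℕ × ℕ => if o = some p.1 then a else 0,
    Finset.Nat.sum_antidiagonal_eq_sum_range_succ fun i _ => if o = some i then a else 0]
  cases o with
  | none => simp
  | some m => simp [ho m rfl]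

theorem sum_antidiagonal_snd_eq {M : Type*} [AddCommMonoid M] (o : Option ℕ)
    (ho : ∀ m ∈ o, m ≤ n) (a : M) :
    ∑ p : {p : ℕ × ℕ // p ∈ Finset.HasAntidiagonal.antidiagonal n},
      (if o = some p.1.2 then a else 0) = if o.isSome then a else 0 := by
  rw [← sum_antidiagonal_fst_eq o ho,
    Finset.sum_coe_sort _ fun p : ℕ × ℕ => if o = some p.1 then a else 0,
    Finset.sum_coe_sort _ fun p : ℕ × ℕ => if o = some p.2 then a else 0]
  exact (Finset.Nat.sum_antidiagonal_swap (f := fun p => if o = some p.1 then a else 0))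

end Compositions

/-! ### The alternating sum -/

section SignedAvg

variable {F : Type*} [Field F] [Fintype F] {n k l : ℕ}

variable (F n) in
/-- The alternating sum `∑_c (-1)^{length c} R_c ∘ *R_c` over the compositions of `n`. -/
def signedAvg : invFun F n →ₗ[ℂ] invFun F n :=
  ∑ c : Composition n, (-1 : ℂ) ^ c.length • hcAvg (compBlocks c)

/-- The signs combine because n + (n - length) has the parity of length. -/
theorem signedAvg_eq (χ : BorelLeviChoice F n) :
    (-1 : ℂ) ^ n • duality χ = signedAvg F n := by
  rw [duality, signedAvg, Finset.smul_sum]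
  refine Finset.sum_congr rfl fun c _ => ?_
  rw [hcInd_comp_hcRes, smul_smul]
  congr 1
  obtain ⟨m, hm⟩ := Nat.exists_eq_add_of_le c.length_le
  have h : n - c.length = m := by omega
  rw [h, ← pow_add, show n + m = c.length + 2 * m by omega, pow_add, pow_mul]
  simp

theorem hcAvg_zero (b : Fin 0 → ℕ) : (hcAvg b : invFun F 0 →ₗ[ℂ] _) = LinearMap.id :=
  hcAvg_of_const b fun i => i.elim0

variable (F) in
/-- The component `(S, T) ↦ m_{k,l} ∘ (S ⊗ T) ∘ m*_{k,l}` of the convolution product. -/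
def convComp (hn : k + l = n) : (invFun F k →ₗ[ℂ] invFun F k) →ₗ[ℂ]
    (invFun F l →ₗ[ℂ] invFun F l) →ₗ[ℂ] (invFun F n →ₗ[ℂ] invFun F n) :=
  LinearMap.mk₂ ℂ (fun S T => mulComp F hn ∘ₗ TensorProduct.map S T ∘ₗ comulComp F hn)
    (fun S S' T => by
      rw [TensorProduct.map_add_left, LinearMap.add_comp, LinearMap.comp_add])
    (fun c S T => by
      rw [TensorProduct.map_smul_left, LinearMap.smul_comp, LinearMap.comp_smul])
    (fun S T T' => by
      rw [TensorProduct.map_add_right, LinearMap.add_comp, LinearMap.comp_add])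
    (fun c S T => by
      rw [TensorProduct.map_smul_right, LinearMap.smul_comp, LinearMap.comp_smul])

theorem convComp_apply (hn : k + l = n) (S : invFun F k →ₗ[ℂ] invFun F k)
    (T : invFun F l →ₗ[ℂ] invFun F l) :
    convComp F hn S T = mulComp F hn ∘ₗ TensorProduct.map S T ∘ₗ comulComp F hn :=
  rfl

theorem IsConcat.convComp_eq {b : Fin (k + l) → ℕ} {b₁ : Fin k → ℕ} {b₂ : Fin l → ℕ}
    (hb : IsConcat b b₁ b₂) : convComp F rfl (hcAvg b₁) (hcAvg b₂) = hcAvg b :=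
  hb.hcAvg_eq.symm

theorem hcAvg_single (hn : 0 < n) :
    (hcAvg (compBlocks (Composition.single n hn)) : invFun F n →ₗ[ℂ] _) = LinearMap.id :=
  hcAvg_of_const _ (compBlocks_const_of_length_le_one (by simp))

/-- For l > 0 the identity of C_l is the operator of a single block, which transitivity appends to
each composition; the extra 1 in the exponent restores the sign of the shorter one. No composition
has last block 0, so for l = 0 only the first term remains. -/
theorem convComp_signedAvg_id (hn : k + l = n) :
    convComp F hn (signedAvg F k) LinearMap.id =
      (if some 0 = some l then signedAvg F n else 0) + ∑ c : Composition n,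
        if c.blocks.getLast? = some l then
          (-1 : ℂ) ^ (c.length + 1) • hcAvg (compBlocks c) else 0 := by
  subst hn
  simp only [signedAvg, map_sum, map_smul, LinearMap.sum_apply, LinearMap.smul_apply]
  rcases Nat.eq_zero_or_pos l with rfl | hl
  · have h : ∀ c : Composition (k + 0), ¬ c.blocks.getLast? = some 0 := fun c hc =>
      (c.blocks_pos (List.mem_of_getLast? hc)).ne rfl
    simp only [h, if_false, if_true, Finset.sum_const_zero, add_zero]
    refine Finset.sum_congr rfl fun c _ => ?_
    have hc : IsConcat (k := k) (l := 0) (compBlocks c) (compBlocks c) (fun i => i.elim0) :=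
      ⟨fun i j => Iff.rfl, fun i => i.elim0, fun _ j => j.elim0⟩
    rw [← hcAvg_zero (fun i => i.elim0), hc.convComp_eq]
  · rw [if_neg (by simpa using hl.ne), zero_add, ← sum_append_single hl
      fun c => (-1 : ℂ) ^ (c.length + 1) • hcAvg (compBlocks c)]
    refine Finset.sum_congr rfl fun c _ => ?_
    rw [← hcAvg_single hl, (isConcat_append c _).convComp_eq]
    congr 1
    simp [Composition.length, pow_succ]

theorem convComp_id_signedAvg (hn : k + l = n) :
    convComp F hn LinearMap.id (signedAvg F l) =
      (if some 0 = some k then signedAvg F n else 0) + ∑ c : Composition n,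
        if c.blocks.head? = some k then
          (-1 : ℂ) ^ (c.length + 1) • hcAvg (compBlocks c) else 0 := by
  rcases Nat.eq_zero_or_pos k with rfl | hk
  · obtain rfl : l = n := by omega
    have h : ∀ c : Composition l, ¬ c.blocks.head? = some 0 := fun c hc =>
      (c.blocks_pos (List.mem_of_head? hc)).ne rfl
    simp only [h, if_false, if_true, Finset.sum_const_zero, add_zero]
    simp only [signedAvg, map_sum, map_smul]
    refine Finset.sum_congr rfl fun c _ => congrArg _ ?_
    have hc : IsConcat (k := 0) (l := l) (compBlocks c ∘ finCongr hn) (fun i => i.elim0)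
        (compBlocks c) := by
      have e : ∀ i, finCongr hn (Fin.natAdd 0 i) = i := fun i => Fin.ext (by simp)
      exact ⟨fun i => i.elim0, fun i j => by simp only [Function.comp_apply, e],
        fun i => i.elim0⟩
    have h1 := hc.convComp_eq (F := F)
    rw [hcAvg_zero] at h1
    -- Unlike k + 0, the index 0 + l does not reduce to l, so the labelling is transported along a
    -- general equality that can be eliminated.
    have key : ∀ (m : ℕ) (hm : 0 + l = m) (b : Fin m → ℕ),
        convComp F rfl LinearMap.id (hcAvg (compBlocks c)) = hcAvg (b ∘ finCongr hm) →
          convComp F hm LinearMap.id (hcAvg (compBlocks c)) = hcAvg b := by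
      rintro m rfl b h
      exact h
    exact key l hn _ h1
  · subst hn
    simp only [signedAvg, map_sum, map_smul]
    rw [if_neg (by simpa using hk.ne), zero_add, ← sum_single_append hk
      fun c => (-1 : ℂ) ^ (c.length + 1) • hcAvg (compBlocks c)]
    refine Finset.sum_congr rfl fun c _ => ?_
    rw [← hcAvg_single hk, (isConcat_append _ c).convComp_eq]
    congr 1
    simp [Composition.length, pow_succ]

/-- Each nonempty composition meets itself with the opposite sign; in degree 0 the empty composition
has no partner and contributes the identity. -/
theorem signedAvg_add_sum (o : Composition n → Option ℕ) (ho : ∀ c, (o c).isSome ↔ c.blocks ≠ []) :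
    signedAvg F n + ∑ c : Composition n,
      (if (o c).isSome then (-1 : ℂ) ^ (c.length + 1) • hcAvg (compBlocks c) else 0) =
        if n = 0 then LinearMap.id else 0 := by
  simp only [ho, ne_eq, Composition.blocks_eq_nil]
  split_ifs with hn
  · subst hn
    have h : ∀ c : Composition 0, c.length = 0 := fun c => c.length_eq_zero.2 rfl
    simp [signedAvg, hcAvg_zero, h, composition_card]
  · rw [signedAvg, ← Finset.sum_add_distrib]
    refine Finset.sum_eq_zero fun c _ => ?_
    rw [← add_smul, pow_succ, mul_neg_one, add_neg_cancel, zero_smul]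

theorem sum_convComp_signedAvg_id :
    ∑ p : {p : ℕ × ℕ // p ∈ Finset.HasAntidiagonal.antidiagonal n},
      convComp F (Finset.HasAntidiagonal.mem_antidiagonal.1 p.2) (signedAvg F p.1.1)
        LinearMap.id = if n = 0 then LinearMap.id else 0 := by
  simp only [convComp_signedAvg_id, Finset.sum_add_distrib]
  -- The l = 0 term occurs once; after the exchange, each nonempty composition is counted once, at
  -- its last block.
  rw [sum_antidiagonal_snd_eq (some 0) (by simp), Finset.sum_comm]
  rw [← signedAvg_add_sum (fun c => c.blocks.getLast?) (by simp)]
  congr 1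
  refine Finset.sum_congr rfl fun c _ => sum_antidiagonal_snd_eq _ (fun m hm => ?_) _
  exact c.blocks_le (List.mem_of_getLast? hm)

theorem sum_convComp_id_signedAvg :
    ∑ p : {p : ℕ × ℕ // p ∈ Finset.HasAntidiagonal.antidiagonal n},
      convComp F (Finset.HasAntidiagonal.mem_antidiagonal.1 p.2) LinearMap.id
        (signedAvg F p.1.2) = if n = 0 then LinearMap.id else 0 := by
  simp only [convComp_id_signedAvg, Finset.sum_add_distrib]
  rw [sum_antidiagonal_fst_eq (some 0) (by simp), Finset.sum_comm]
  rw [← signedAvg_add_sum (fun c => c.blocks.head?) (by simp)]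
  congr 1
  refine Finset.sum_congr rfl fun c _ => sum_antidiagonal_fst_eq _ (fun m hm => ?_) _
  exact c.blocks_le (List.mem_of_head? hm)

end SignedAvg

/-! ### Convolution on graded components -/

section Convolution

variable {F : Type*} [Field F] [Fintype F] {n k l : ℕ}

variable (F n) in
/-- The inclusion `Cₙ(q) → C(q)`. -/
abbrev incl : invFun F n →ₗ[ℂ] Cq F := DirectSum.lof ℂ ℕ (fun n => invFun F n) n

theorem mul_comp_map_incl (hn : k + l = n) :
    mul F ∘ₗ TensorProduct.map (incl F k) (incl F l) = incl F n ∘ₗ mulComp F hn := by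
  subst hn
  refine TensorProduct.ext' fun f g => ?_
  simp [mul, DirectSum.toModule_lof]

theorem comul_comp_incl : comul F ∘ₗ incl F n =
    ∑ p : {p : ℕ × ℕ // p ∈ Finset.HasAntidiagonal.antidiagonal n},
      TensorProduct.map (incl F p.1.1) (incl F p.1.2) ∘ₗ
        comulComp F (Finset.HasAntidiagonal.mem_antidiagonal.1 p.2) :=
  LinearMap.ext fun f => by rw [comul, LinearMap.comp_apply, DirectSum.toModule_lof]

theorem convolution_comp_incl (S T : Cq F →ₗ[ℂ] Cq F) : convolution S T ∘ₗ incl F n =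
    ∑ p : {p : ℕ × ℕ // p ∈ Finset.HasAntidiagonal.antidiagonal n},
      mul F ∘ₗ TensorProduct.map (S ∘ₗ incl F p.1.1) (T ∘ₗ incl F p.1.2) ∘ₗ
        comulComp F (Finset.HasAntidiagonal.mem_antidiagonal.1 p.2) := by
  rw [convolution, LinearMap.comp_assoc, LinearMap.comp_assoc, comul_comp_incl]
  simp only [TensorProduct.map_comp]
  refine LinearMap.ext fun f => ?_
  simp only [LinearMap.comp_apply, LinearMap.sum_apply, map_sum]

theorem convolution_comp_incl_of_graded {S T : Cq F →ₗ[ℂ] Cq F}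
    {s t : ∀ n, invFun F n →ₗ[ℂ] invFun F n} (hS : ∀ n, S ∘ₗ incl F n = incl F n ∘ₗ s n)
    (hT : ∀ n, T ∘ₗ incl F n = incl F n ∘ₗ t n) : convolution S T ∘ₗ incl F n =
    incl F n ∘ₗ ∑ p : {p : ℕ × ℕ // p ∈ Finset.HasAntidiagonal.antidiagonal n},
      convComp F (Finset.HasAntidiagonal.mem_antidiagonal.1 p.2) (s p.1.1) (t p.1.2) := by
  rw [convolution_comp_incl]
  refine LinearMap.ext fun f => ?_
  simp only [LinearMap.comp_apply, LinearMap.sum_apply, map_sum]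
  refine Finset.sum_congr rfl fun p _ => ?_
  rw [hS, hT, TensorProduct.map_comp, convComp_apply, LinearMap.comp_apply]
  exact LinearMap.congr_fun (mul_comp_map_incl (Finset.HasAntidiagonal.mem_antidiagonal.1 p.2)) _

omit [Fintype F] in
theorem unit_comp_counit_comp_incl : (unit F ∘ₗ counit F) ∘ₗ incl F n =
    incl F n ∘ₗ (if n = 0 then LinearMap.id else 0) := by
  refine LinearMap.ext fun f => ?_
  split_ifs with hn
  · subst hn
    simp only [unit, counit, LinearMap.comp_apply, LinearMap.id_apply, DirectSum.component.lof_self]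
    refine congrArg (incl F 0) (Subtype.ext (funext fun x => ?_))
    -- 𝔤𝔩₀ is a single point, so f is the constant function with value f(0).
    exact congrArg f.1 (Subsingleton.elim _ _)
  · have h : DirectSum.component ℂ ℕ (fun n => invFun F n) 0 (incl F n f) = 0 := by
      rw [DirectSum.component.of, dif_neg hn]
    simp only [counit, LinearMap.comp_apply, h, map_zero, LinearMap.zero_apply]

theorem signedDuality_comp_incl (χ : (n : ℕ) → BorelLeviChoice F n) (n : ℕ) :
    signedDuality χ ∘ₗ incl F n = incl F n ∘ₗ signedAvg F n := by
  refine LinearMap.ext fun f => ?_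
  rw [← signedAvg_eq (χ n)]
  exact DirectSum.lmap_lof _ _ _

theorem isAntipode_signedDuality (χ : (n : ℕ) → BorelLeviChoice F n) :
    IsAntipode (signedDuality χ) := by
  constructor <;> refine DirectSum.linearMap_ext ℂ fun n => ?_
  · rw [convolution_comp_incl_of_graded (signedDuality_comp_incl χ) (t := fun _ => LinearMap.id)
      (fun _ => rfl), sum_convComp_signedAvg_id, unit_comp_counit_comp_incl]
  · rw [convolution_comp_incl_of_graded (s := fun _ => LinearMap.id) (fun _ => rfl)
      (signedDuality_comp_incl χ), sum_convComp_id_signedAvg, unit_comp_counit_comp_incl]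

/-! ### Uniqueness of the antipode -/

variable (F) in
/-- The unit `1 ∈ C₀(q)`. -/
def oneZero : invFun F 0 := ⟨fun _ => 1, fun _ _ => rfl⟩

/-- With an empty second block the nilradical is zero, so restriction changes nothing. -/
theorem comulComp_zero_right (hn : k + 0 = k) (f : invFun F k) :
    comulComp F hn f = f ⊗ₜ[ℂ] oneZero F := by
  classical
  apply boxTensor_injective
  rw [boxTensor_comulComp]
  refine Subtype.ext (funext fun z => ?_)
  have hb : twoBlocks k k = fun _ => 0 := funext fun i => if_pos i.2
  have hU : ∀ u : unipLie (1 : GL (Fin k) F) (twoBlocks k k), (u : Mat F k) = 0 := fun u => by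
    ext i j
    exact mem_unipLie_one.1 u.2 i j (by rw [hb])
  have hsub : Subsingleton (unipLie (1 : GL (Fin k) F) (twoBlocks k k)) :=
    ⟨fun u v => Subtype.ext ((hU u).trans (hU v).symm)⟩
  have hD : (blockDiag (n := k + 0) rfl z.1 z.2).1 = z.1 := by
    ext i j
    exact blockDiag_castAdd_castAdd z.1 z.2 i j
  have h1 : (resProd F hn f).1 z = f.1 z.1 := by
    have h2 := resProd_apply (k := k) (l := 0) f z.1 z.2
    refine h2.trans ?_
    rw [hD]
    have h3 : ∀ u : unipLie (1 : GL (Fin k) F) (twoBlocks k k), f.1 (z.1 + u) = f.1 z.1 :=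
      fun u => by rw [hU, add_zero]
    have h4 : Nat.card (unipLie (1 : GL (Fin k) F) (twoBlocks k k)) = 1 :=
      Nat.card_unique
    change (Nat.card (unipLie (1 : GL (Fin k) F) (twoBlocks k k)) : ℂ)⁻¹ *
      ∑ u : unipLie (1 : GL (Fin k) F) (twoBlocks k k), f.1 (z.1 + u) = _
    rw [Finset.sum_congr rfl fun u _ => h3 u, Finset.sum_const, Finset.card_univ,
      ← Nat.card_eq_fintype_card, h4]
    simp
  rw [h1, boxTensor_tmul]
  simp [oneZero]

/-- On Cₙ, f ⊗ 1 is m*_{n,0} f, and m_{n,0} ∘ m*_{n,0} is `R ∘ *R` for the whole group, hence the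
identity. -/
theorem mul_tmul_one (x : Cq F) : mul F (x ⊗ₜ[ℂ] incl F 0 (oneZero F)) = x := by
  induction x using DirectSum.induction_on with
  | zero => simp
  | add x y hx hy => rw [TensorProduct.add_tmul, map_add, hx, hy]
  | of n f =>
    have h1 : convComp F (add_zero n) LinearMap.id LinearMap.id =
        LinearMap.id (M := invFun F n) := by
      have hc : IsConcat (k := n) (l := 0) (fun _ => 0) (fun _ => 0) (fun _ => 0) :=
        ⟨fun i j => Iff.rfl, fun i => i.elim0, fun _ j => j.elim0⟩
      have h2 := hc.convComp_eq (F := F)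
      rw [hcAvg_zero, hcAvg_of_const _ fun _ _ => rfl, hcAvg_of_const _ fun _ _ => rfl] at h2
      exact h2
    have h2 := LinearMap.congr_fun h1 f
    rw [convComp_apply, TensorProduct.map_id, LinearMap.comp_apply, LinearMap.id_comp,
      comulComp_zero_right] at h2
    have h3 := LinearMap.congr_fun (mul_comp_map_incl (F := F) (add_zero n)) (f ⊗ₜ oneZero F)
    rw [LinearMap.comp_apply, LinearMap.comp_apply, TensorProduct.map_tmul, h2] at h3
    exact h3

/-- Strong induction on degree: the (n, 0) term is D on Cₙ, and the others vanish by the induction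
hypothesis. D need not be graded. -/
theorem eq_zero_of_convolution_id_eq_zero {D : Cq F →ₗ[ℂ] Cq F}
    (hD : convolution D LinearMap.id = 0) : D = 0 := by
  refine DirectSum.linearMap_ext ℂ fun n => ?_
  change D ∘ₗ incl F n = 0
  induction n using Nat.strong_induction_on with
  | _ n ih =>
    have h := convolution_comp_incl (n := n) D LinearMap.id
    rw [hD, LinearMap.zero_comp, Fintype.sum_eq_single ⟨(n, 0), by simp⟩] at h
    · refine LinearMap.ext fun f => ?_
      have h1 := LinearMap.congr_fun h f
      simp only [LinearMap.comp_apply, comulComp_zero_right, TensorProduct.map_tmul,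
        LinearMap.id_apply, mul_tmul_one] at h1
      exact h1.symm
    · rintro ⟨⟨k, l⟩, hp⟩ hne
      have hkl : k + l = n := Finset.HasAntidiagonal.mem_antidiagonal.1 hp
      have hk : k < n := by
        rcases Nat.eq_zero_or_pos l with rfl | hl
        · exact absurd (Subtype.ext (by simp [← hkl])) hne
        · omega
      simp only [ih k hk, TensorProduct.map_zero_left, LinearMap.zero_comp, LinearMap.comp_zero]

/-- Convolution is linear in its first argument, so the difference of two antipodes is killed by
convolution with the identity. Only the left inverse property is used. -/
theorem IsAntipode.eq {S T : Cq F →ₗ[ℂ] Cq F} (hS : IsAntipode S) (hT : IsAntipode T) : S = T := by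
  have h : convolution (S + (-1 : ℂ) • T) LinearMap.id = 0 := by
    have h1 : convolution (S + (-1 : ℂ) • T) LinearMap.id =
        convolution S LinearMap.id + (-1 : ℂ) • convolution T LinearMap.id := by
      simp only [convolution, TensorProduct.map_add_left, TensorProduct.map_smul_left,
        LinearMap.add_comp, LinearMap.comp_add, LinearMap.smul_comp, LinearMap.comp_smul]
    have h2 : unit F ∘ₗ counit F + (-1 : ℂ) • (unit F ∘ₗ counit F) =
        ((1 : ℂ) + -1) • (unit F ∘ₗ counit F) := by rw [add_smul, one_smul]
    rw [h1, hS.1, hT.1, h2, add_neg_cancel, zero_smul]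
  calc S = S + ((-1 : ℂ) + 1) • T := by rw [neg_add_cancel, zero_smul, add_zero]
    _ = T := by
      rw [add_smul, ← add_assoc, eq_zero_of_convolution_id_eq_zero h, zero_add, one_smul]

end Convolution

end GLInv

end

theorem mainTheorem6 (F : Type*) [Field F] [Fintype F]
    (χ : (n : ℕ) → GLInv.BorelLeviChoice F n) :
    (∃! S : GLInv.Cq F →ₗ[ℂ] GLInv.Cq F, GLInv.IsAntipode S) ∧
    ∀ S : GLInv.Cq F →ₗ[ℂ] GLInv.Cq F, GLInv.IsAntipode S →
      S = GLInv.signedDuality χ ∧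
      ∀ (n : ℕ) (f : GLInv.invFun F n),
        DirectSum.lof ℂ ℕ (fun m => GLInv.invFun F m) n (GLInv.duality (χ n) f) =
          (-1 : ℂ) ^ n • S (DirectSum.lof ℂ ℕ (fun m => GLInv.invFun F m) n f) := by
  have hχ := GLInv.isAntipode_signedDuality χ
  refine ⟨⟨_, hχ, fun S hS => hS.eq hχ⟩, fun S hS => ?_⟩
  obtain rfl := hS.eq hχ
  refine ⟨rfl, fun n f => ?_⟩
  rw [GLInv.signedDuality, DirectSum.lmap_lof, LinearMap.smul_apply, map_smul, smul_smul,
    ← mul_pow]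
  simp
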